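/- Let $n = 2m+1$ with $m \ge 1$, and let $Cl_n$ be the real Clifford algebra generated by $e_1,\dots,e_n$ with $e_ie_j+e_je_i=-2\delta_{ij}$. Let $\mathfrak{spin}(n)\subset Cl_n$ be the Lie algebra spanned by the commutators $[e_k,e_l]$, and let weights $\lambda=(\lambda^1,\dots,\lambda^m)$ and highest weights refer to the Cartan subalgebra spanned by the $[e_{2j-1},e_{2j}]$ (acting on a vector of weight $\lambda$ by $4\sqrt{-1}\,\lambda^j$) and to the positive roots $\varepsilon_i\pm\varepsilon_j$ $(i<j)$, $\varepsilon_i$. Let $V_\Delta$ be a spinor space, i.e. a finite-dimensional irreducible complex module over $Cl_n$. For $q\ge 0$ let $H^q$ be the space of complex harmonic homogeneous polynomials of degree $q$ on $\mathbf R^n$. Let $[e_k,e_l]\in\mathfrak{spin}(n)$ act on polynomials by $4(-x_k\partial_l+x_l\partial_k)$, on $V_\Delta$ through the Clifford action, and on $H^q\otimes V_\Delta$ by the tensor product representation. On $V_\Delta$-valued polynomials let $x=\sum_i x_ie_i$ (Clifford multiplication) and $D=\sum_i e_i\,\partial/\partial x_i$ (Dirac operator). Then $V_\Delta$ is an irreducible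 representation of $\mathfrak{spin}(n)$ with highest weight $\Delta=((1/2)_m)$, where $(1/2)_j$ denotes a string of $j$ entries $1/2$. Moreover $H^q\otimes V_\Delta$ has a direct sum decomposition $$H^q\otimes V_\Delta = V_{\mu_0}\oplus V_{\mu_1},\qquad \mu_0=(q+\tfrac12,(\tfrac12)_{m-1}),\quad \mu_1=(q-\tfrac12,(\tfrac12)_{m-1}),$$ where $V_{\mu}$ is an irreducible subrepresentation of $\mathfrak{spin}(n)$ with highest weight $\mu$; for $q=0$ the weight $\mu_1$ is not dominant and the summand $V_{\mu_1}$ is $0$. For every such decomposition, $$-xD = 0 \ \text{ on } V_{\mu_0},\qquad -xD = n+2q-2 \ \text{ on } V_{\mu_1},$$ and in particular $V_{\mu_0}=\ker D$, the kernel of $D$ on $H^q\otimes V_\Delta$, and $V_{\mu_1}\cong (H^q\otimes V_\Delta)/\ker D$ by the quotient map. -/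

import Mathlib

open scoped TensorProduct

attribute [local instance 100] LieRing.ofAssociativeRing

namespace SpinorHarmonic

noncomputable section

/-! ### The Clifford algebra and the Lie algebra `spin(n)` -/

/-- The negative definite form `v ↦ -(v₁² + ⋯ + vₙ²)` on `ℝⁿ`. -/
abbrev negForm (n : ℕ) : QuadraticForm ℝ (Fin n → ℝ) :=
  QuadraticMap.weightedSumSquares ℝ (fun _ : Fin n => (-1 : ℝ))

/-- The Clifford algebra of `ℝⁿ`, with `eᵢ eⱼ + eⱼ eᵢ = -2 δᵢⱼ`. -/
abbrev Cl (n : ℕ) : Type := CliffordAlgebra (negForm n)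

/-- The standard generators `eᵢ` of the Clifford algebra. -/
def e {n : ℕ} (i : Fin n) : Cl n := CliffordAlgebra.ι (negForm n) (Pi.single i 1)

theorem e_mul_e_add {n : ℕ} (i j : Fin n) :
    e i * e j + e j * e i = algebraMap ℝ (Cl n) (if i = j then -2 else 0) := by
  rw [e, e, CliffordAlgebra.ι_mul_ι_add_swap]
  congr 1
  simp only [QuadraticMap.polar, QuadraticMap.weightedSumSquares_apply, Pi.add_apply, smul_eq_mul,
    ← Finset.sum_sub_distrib]
  have h : ∀ k : Fin n, -1 * (((Pi.single i 1 : Fin n → ℝ) k + (Pi.single j 1 : Fin n → ℝ) k) *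
      ((Pi.single i 1 : Fin n → ℝ) k + (Pi.single j 1 : Fin n → ℝ) k)) -
      -1 * ((Pi.single i 1 : Fin n → ℝ) k * (Pi.single i 1 : Fin n → ℝ) k) -
      -1 * ((Pi.single j 1 : Fin n → ℝ) k * (Pi.single j 1 : Fin n → ℝ) k) =
      (Pi.single i 1 : Fin n → ℝ) k * (-2 * (Pi.single j 1 : Fin n → ℝ) k) := fun k => by ring
  rw [Finset.sum_congr rfl fun k _ => h k]
  by_cases hij : i = j
  · subst hij
    simp [Pi.single_apply]
  · simp [Pi.single_apply, hij, Ne.symm hij]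

theorem lie_e_e_e {n : ℕ} (k l i : Fin n) :
    ⁅⁅(e k : Cl n), e l⁆, e i⁆ =
      (if i = k then (4 : ℝ) else 0) • e l - (if i = l then (4 : ℝ) else 0) • e k := by
  have h1 := e_mul_e_add l i
  have h2 := e_mul_e_add k i
  have key : ⁅⁅(e k : Cl n), e l⁆, e i⁆ =
      e k * (e l * e i + e i * e l) - (e k * e i + e i * e k) * e l
        - e l * (e k * e i + e i * e k) + (e l * e i + e i * e l) * e k := by
    simp only [Ring.lie_def]
    noncomm_ring
  rw [key, h1, h2, ← Algebra.commutes, ← Algebra.commutes (_ : ℝ) (e l), ← Algebra.smul_def,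
    ← Algebra.smul_def]
  simp only [eq_comm (a := i)]
  split_ifs <;> module

/-- `spin(n)`: the linear span of the commutators `[eₖ, eₗ]` in the Clifford algebra, with the
commutator bracket. -/
def spinLie (n : ℕ) : LieSubalgebra ℝ (Cl n) where
  __ := Submodule.span ℝ (Set.range fun p : Fin n × Fin n => ⁅(e p.1 : Cl n), e p.2⁆)
  lie_mem' := by
    intro x y hx hy
    change x ∈ Submodule.span ℝ _ at hx
    change y ∈ Submodule.span ℝ _ at hy
    change ⁅x, y⁆ ∈ Submodule.span ℝ _
    induction hx using Submodule.span_induction with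
    | zero => simp
    | add a b _ _ ha hb => rw [add_lie]; exact Submodule.add_mem _ ha hb
    | smul c a _ ha => rw [smul_lie]; exact Submodule.smul_mem _ c ha
    | mem a ha =>
      obtain ⟨⟨k, l⟩, rfl⟩ := ha
      induction hy using Submodule.span_induction with
      | zero => simp
      | add a b _ _ ha hb => rw [lie_add]; exact Submodule.add_mem _ ha hb
      | smul c a _ ha => rw [lie_smul]; exact Submodule.smul_mem _ c ha
      | mem b hb =>
        obtain ⟨⟨i, j⟩, rfl⟩ := hb
        have hm : ∀ a b : Fin n, ⁅(e a : Cl n), e b⁆ ∈ Submodule.span ℝ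
            (Set.range fun p : Fin n × Fin n => ⁅(e p.1 : Cl n), e p.2⁆) :=
          fun a b => Submodule.subset_span ⟨(a, b), rfl⟩
        simp only
        rw [leibniz_lie, lie_e_e_e, lie_e_e_e, sub_lie, lie_sub, smul_lie, smul_lie, lie_smul,
          lie_smul]
        exact Submodule.add_mem _
          (Submodule.sub_mem _ (Submodule.smul_mem _ _ (hm _ _)) (Submodule.smul_mem _ _ (hm _ _)))
          (Submodule.sub_mem _ (Submodule.smul_mem _ _ (hm _ _)) (Submodule.smul_mem _ _ (hm _ _)))

/-- The element `[eₖ, eₗ]` of `spin(n)`. -/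
def br {n : ℕ} (k l : Fin n) : spinLie n :=
  ⟨⁅(e k : Cl n), e l⁆, Submodule.subset_span ⟨(k, l), rfl⟩⟩

/-- The projection of the Clifford algebra onto its vectors, a left inverse of `ι`. -/
def vec (n : ℕ) : Cl n →ₗ[ℝ] (Fin n → ℝ) :=
  ExteriorAlgebra.ιInv ∘ₗ (CliffordAlgebra.equivExterior (negForm n)).toLinearMap

theorem vec_e {n : ℕ} (i : Fin n) : vec n (e i) = Pi.single i 1 := by
  simp [vec, e, CliffordAlgebra.equivExterior, ExteriorAlgebra.ι_leftInverse _]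

/-- The matrix entries of the adjoint action on `ℝⁿ`: `[A, eⱼ] = ∑ᵢ (adEntry A i j) eᵢ` for
`A ∈ spin(n)`. -/
def adEntry {n : ℕ} (A : Cl n) (i j : Fin n) : ℝ := vec n ⁅A, e j⁆ i

theorem lie_e_eq_sum {n : ℕ} (A : spinLie n) (j : Fin n) :
    ⁅(A : Cl n), e j⁆ = ∑ i, adEntry (A : Cl n) i j • e i := by
  obtain ⟨A, hA⟩ := A
  change A ∈ Submodule.span ℝ _ at hA
  simp only
  induction hA using Submodule.span_induction with
  | zero => simp [adEntry]
  | add a b _ _ ha hb =>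
    rw [add_lie, ha, hb, ← Finset.sum_add_distrib]
    simp [adEntry, add_lie, add_smul]
  | smul c a _ ha =>
    rw [smul_lie, ha, Finset.smul_sum]
    simp [adEntry, smul_lie, smul_smul]
  | mem a ha =>
    obtain ⟨⟨k, l⟩, rfl⟩ := ha
    have h : ∀ (c : ℝ) (l : Fin n), ∑ i, (c • (Pi.single l 1 : Fin n → ℝ)) i • (e i : Cl n) =
        c • e l := fun c l => by
      simp [Pi.single_apply]
    simp only [adEntry, lie_e_e_e]
    generalize (if j = k then (4 : ℝ) else 0) = c
    generalize (if j = l then (4 : ℝ) else 0) = d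
    rw [map_sub, map_smul, map_smul, vec_e, vec_e]
    simp only [Pi.sub_apply, sub_smul, Finset.sum_sub_distrib, h]

theorem adEntry_lie {n : ℕ} (A B : spinLie n) (i j : Fin n) :
    adEntry (⁅A, B⁆ : spinLie n) i j =
      ∑ k, (adEntry (A : Cl n) i k * adEntry (B : Cl n) k j -
        adEntry (B : Cl n) i k * adEntry (A : Cl n) k j) := by
  have h : ⁅((⁅A, B⁆ : spinLie n) : Cl n), e j⁆ =
      ⁅(A : Cl n), ⁅(B : Cl n), e j⁆⁆ - ⁅(B : Cl n), ⁅(A : Cl n), e j⁆⁆ := by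
    rw [LieSubalgebra.coe_bracket, lie_lie]
  rw [adEntry, h, lie_e_eq_sum B, lie_e_eq_sum A]
  simp only [lie_sum, lie_smul, map_sub, map_sum, map_smul, Pi.sub_apply, Finset.sum_apply,
    Pi.smul_apply, smul_eq_mul, Finset.sum_sub_distrib]
  congr 1 <;> exact Finset.sum_congr rfl fun k _ => mul_comm _ _

/-! ### Representations of `spin(n)` -/

/-- A representation of `spin(n)` on a complex vector space. -/
abbrev SpinRep (n : ℕ) (U : Type*) [AddCommGroup U] [Module ℂ U] :=
  spinLie n →ₗ⁅ℝ⁆ Module.End ℂ U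

/-- The vector field `-∑ᵢⱼ aᵢⱼ xⱼ ∂ᵢ`, where `a` is the matrix of the adjoint action of `A`. -/
def polyDer {n : ℕ} (A : Cl n) : Derivation ℂ (MvPolynomial (Fin n) ℂ) (MvPolynomial (Fin n) ℂ) :=
  MvPolynomial.mkDerivation ℂ
    fun i => -∑ j, MvPolynomial.C (adEntry A i j : ℂ) * MvPolynomial.X j

/-- The polynomial representation of `spin(n)`, the derivative of `f ↦ f ∘ g⁻¹`. -/
def polyRep (n : ℕ) : SpinRep n (MvPolynomial (Fin n) ℂ) where
  toFun A := (polyDer (A : Cl n)).toLinearMap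
  map_add' A B := by
    have : polyDer ((A + B : spinLie n) : Cl n) = polyDer (A : Cl n) + polyDer (B : Cl n) := by
      refine MvPolynomial.derivation_ext fun i => ?_
      simp only [polyDer, Derivation.add_apply, MvPolynomial.mkDerivation_X, ← neg_add,
        ← Finset.sum_add_distrib]
      simp [adEntry, add_lie, add_mul]
    rw [this]; rfl
  map_smul' c A := by
    have : polyDer ((c • A : spinLie n) : Cl n) = (c : ℂ) • polyDer (A : Cl n) := by
      refine MvPolynomial.derivation_ext fun i => ?_
      simp only [polyDer, Derivation.smul_apply, MvPolynomial.mkDerivation_X, smul_neg,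
        Finset.smul_sum]
      simp [adEntry, smul_lie, MvPolynomial.smul_eq_C_mul, mul_assoc]
    rw [this]; rfl
  map_lie' {A B} := by
    have : polyDer ((⁅A, B⁆ : spinLie n) : Cl n) = ⁅polyDer (A : Cl n), polyDer (B : Cl n)⁆ := by
      refine MvPolynomial.derivation_ext fun i => ?_
      rw [Derivation.commutator_apply]
      have h : ∀ A B : Cl n, polyDer A (polyDer B (MvPolynomial.X i)) =
          ∑ j, ∑ k, MvPolynomial.C (adEntry B i k * adEntry A k j : ℂ) * MvPolynomial.X j := by
        intro A B
        simp only [polyDer, MvPolynomial.mkDerivation_X, map_neg, map_sum, Derivation.leibniz,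
          MvPolynomial.derivation_C, smul_eq_mul, mul_zero, add_zero, mul_neg,
          Finset.mul_sum, Finset.sum_neg_distrib, neg_neg, map_mul, mul_assoc]
        exact Finset.sum_comm
      rw [h, h, ← Finset.sum_sub_distrib]
      simp only [polyDer, MvPolynomial.mkDerivation_X, adEntry_lie]
      rw [← Finset.sum_neg_distrib]
      refine Finset.sum_congr rfl fun j _ => ?_
      rw [← Finset.sum_mul, ← Finset.sum_mul, ← sub_mul, ← neg_mul, ← Finset.sum_sub_distrib]
      congr 1
      simp only [Complex.ofReal_sum, map_sum, Complex.ofReal_sub, Complex.ofReal_mul, map_sub,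
        ← Finset.sum_neg_distrib, neg_sub]
    rw [this]; rfl

/-- `[eₖ, eₗ]` acts on polynomials as `4 (-xₖ ∂ₗ + xₗ ∂ₖ)`. -/
theorem polyRep_br {n : ℕ} (k l : Fin n) (f : MvPolynomial (Fin n) ℂ) :
    polyRep n (br k l) f =
      4 * (-(MvPolynomial.X k * MvPolynomial.pderiv l f) +
        MvPolynomial.X l * MvPolynomial.pderiv k f) := by
  have : polyDer ((br k l : spinLie n) : Cl n) =
      (4 : MvPolynomial (Fin n) ℂ) • (-(MvPolynomial.X k : MvPolynomial (Fin n) ℂ) •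
        MvPolynomial.pderiv l + (MvPolynomial.X l : MvPolynomial (Fin n) ℂ) •
        MvPolynomial.pderiv k) := by
    refine MvPolynomial.derivation_ext fun i => ?_
    have h4 : (MvPolynomial.C (4 : ℂ) : MvPolynomial (Fin n) ℂ) = 4 := map_ofNat _ 4
    have h : ∀ j, adEntry ((br k l : spinLie n) : Cl n) i j =
        (if j = k then (4 : ℝ) else 0) * (if i = l then 1 else 0) -
          (if j = l then (4 : ℝ) else 0) * (if i = k then 1 else 0) := fun j => by
      simp only [adEntry, br, lie_e_e_e]
      rw [map_sub, map_smul, map_smul, vec_e, vec_e]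
      simp only [Pi.sub_apply, Pi.smul_apply, Pi.single_apply, smul_eq_mul]
    have hsum : ∀ a b : ℝ, ∑ j, (MvPolynomial.C (((if j = k then (4 : ℝ) else 0) * a -
        (if j = l then (4 : ℝ) else 0) * b : ℝ) : ℂ) : MvPolynomial (Fin n) ℂ) *
          MvPolynomial.X j = 4 * MvPolynomial.C (a : ℂ) * MvPolynomial.X k -
            4 * MvPolynomial.C (b : ℂ) * MvPolynomial.X l := fun a b => by
      simp only [Complex.ofReal_sub, Complex.ofReal_mul, map_sub, map_mul, sub_mul,
        Finset.sum_sub_distrib]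
      simp [apply_ite Complex.ofReal, apply_ite MvPolynomial.C, h4]
    simp only [polyDer, MvPolynomial.mkDerivation_X, h, hsum, Derivation.smul_apply,
      Derivation.add_apply, MvPolynomial.pderiv_X, smul_eq_mul, Pi.single_apply]
    simp only [eq_comm (a := i)]
    split_ifs <;> simp <;> ring
  change polyDer ((br k l : spinLie n) : Cl n) f = _
  rw [this]
  simp [mul_add]

variable {n : ℕ} {V : Type*} [AddCommGroup V] [Module ℂ V]

/-- A complex Clifford module restricts to a representation of `spin(n)`. -/
def spinorRep (γ : Cl n →ₐ[ℝ] Module.End ℂ V) : SpinRep n V where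
  toFun A := γ (A : Cl n)
  map_add' A B := by simp
  map_smul' c A := by simp
  map_lie' {A B} := by simp [Ring.lie_def]

/-- The tensor product of two representations: `A (f ⊗ φ) = A f ⊗ φ + f ⊗ A φ`. -/
def tensorRep {U : Type*} [AddCommGroup U] [Module ℂ U] (ρ : SpinRep n U) (σ : SpinRep n V) :
    SpinRep n (U ⊗[ℂ] V) where
  toFun A := TensorProduct.map (ρ A) LinearMap.id + TensorProduct.map LinearMap.id (σ A)
  map_add' A B := by
    refine TensorProduct.ext' fun f φ => ?_
    simp [TensorProduct.add_tmul, TensorProduct.tmul_add]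
    abel
  map_smul' c A := by
    refine TensorProduct.ext' fun f φ => ?_
    have h₁ : ρ (c • A) f = (c : ℂ) • ρ A f := by rw [map_smul]; rfl
    have h₂ : σ (c • A) φ = (c : ℂ) • σ A φ := by rw [map_smul]; rfl
    change ρ (c • A) f ⊗ₜ[ℂ] φ + f ⊗ₜ[ℂ] σ (c • A) φ =
      (c : ℂ) • (ρ A f ⊗ₜ[ℂ] φ + f ⊗ₜ[ℂ] σ A φ)
    rw [h₁, h₂, smul_add, TensorProduct.tmul_smul]
    rfl
  map_lie' {A B} := by
    refine TensorProduct.ext' fun f φ => ?_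
    simp [Ring.lie_def, TensorProduct.sub_tmul, TensorProduct.tmul_sub]
    abel

/-- `W` is an irreducible subrepresentation of `ρ`. -/
structure IsIrreducibleOn {U : Type*} [AddCommGroup U] [Module ℂ U] (ρ : SpinRep n U)
    (W : Submodule ℂ U) : Prop where
  ne_bot : W ≠ ⊥
  invariant : ∀ A, ∀ w ∈ W, ρ A w ∈ W
  eq_bot_or_eq : ∀ W' ≤ W, (∀ A, ∀ w ∈ W', ρ A w ∈ W') → W' = ⊥ ∨ W' = W

/-- The action of the element `[u, v] = ∑ uₖ vₗ [eₖ, eₗ]` of the complexification of `spin(n)`,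
for `u, v ∈ ℂⁿ`. -/
def brC {U : Type*} [AddCommGroup U] [Module ℂ U] (ρ : SpinRep n U) (u v : Fin n → ℂ) :
    Module.End ℂ U :=
  ∑ k, ∑ l, (u k * v l) • ρ (br k l)

section Weights

variable {m : ℕ}

/-- The indices of the basis vectors `e₁, e₃, …, e₂ₘ₋₁` (one-based). -/
def idxA (j : Fin m) : Fin (2 * m + 1) := ⟨2 * j, by omega⟩

/-- The indices of the basis vectors `e₂, e₄, …, e₂ₘ` (one-based). -/
def idxB (j : Fin m) : Fin (2 * m + 1) := ⟨2 * j + 1, by omega⟩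

/-- The vector `wⱼ = e₂ⱼ₋₁ - i e₂ⱼ` of `ℂ²ᵐ⁺¹`, of weight `εⱼ`. -/
def wPos (j : Fin m) : Fin (2 * m + 1) → ℂ :=
  Pi.single (idxA j) 1 - Complex.I • Pi.single (idxB j) 1

/-- The vector `w̄ⱼ = e₂ⱼ₋₁ + i e₂ⱼ` of `ℂ²ᵐ⁺¹`, of weight `-εⱼ`. -/
def wNeg (j : Fin m) : Fin (2 * m + 1) → ℂ :=
  Pi.single (idxA j) 1 + Complex.I • Pi.single (idxB j) 1

/-- The vector `e₂ₘ₊₁` of `ℂ²ᵐ⁺¹`, of weight `0`. -/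
def wZero (m : ℕ) : Fin (2 * m + 1) → ℂ := Pi.single (Fin.last (2 * m)) 1

/-- `v` is a highest weight vector of weight `wt`, for the Cartan subalgebra spanned by the
`[e₂ⱼ₋₁, e₂ⱼ]` and the positive roots `εᵢ ± εⱼ` (`i < j`) and `εᵢ`, which are the
lexicographically positive ones; their root vectors are `[wᵢ, wⱼ]`, `[wᵢ, w̄ⱼ]` and
`[wᵢ, e₂ₘ₊₁]`. Since `ad [eₖ, eₗ]` rotates the plane of `eₖ, eₗ` with speed `4`, the weight is
read off from `[e₂ⱼ₋₁, e₂ⱼ] v = 4 i wtⱼ v`. -/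
structure IsHighestWeightVector {U : Type*} [AddCommGroup U] [Module ℂ U]
    (ρ : SpinRep (2 * m + 1) U) (wt : Fin m → ℝ) (v : U) : Prop where
  ne_zero : v ≠ 0
  weight : ∀ j, ρ (br (idxA j) (idxB j)) v = (4 * Complex.I * (wt j : ℂ)) • v
  root_add : ∀ i j, i < j → brC ρ (wPos i) (wPos j) v = 0
  root_sub : ∀ i j, i < j → brC ρ (wPos i) (wNeg j) v = 0
  root_short : ∀ i, brC ρ (wPos i) (wZero m) v = 0

/-- `W` is an irreducible subrepresentation of `ρ` with highest weight `wt`. -/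
def IsIrrepOfHighestWeight {U : Type*} [AddCommGroup U] [Module ℂ U]
    (ρ : SpinRep (2 * m + 1) U) (wt : Fin m → ℝ) (W : Submodule ℂ U) : Prop :=
  IsIrreducibleOn ρ W ∧ ∃ v ∈ W, IsHighestWeightVector ρ wt v

/-- The spinor weight `Δ = (1/2, …, 1/2)`. -/
def wtSpin (m : ℕ) : Fin m → ℝ := fun _ => 1 / 2

/-- The weight `(a, 1/2, …, 1/2)`. -/
def wtHook (m : ℕ) (a : ℝ) : Fin m → ℝ := fun j => if (j : ℕ) = 0 then a else 1 / 2

end Weights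

/-- The subspace `W` of `H` maps isomorphically onto the quotient of `H` by `H ∩ K`. -/
def IsQuotientOf {U : Type*} [AddCommGroup U] [Module ℂ U] (W H K : Submodule ℂ U) : Prop :=
  ∃ h : W ≤ H, Function.Bijective ((K.submoduleOf H).mkQ ∘ₗ Submodule.inclusion h)

/-! ### Spinor-valued harmonic polynomials -/

/-- `γ` makes `V` a space of spinors: `V` is an irreducible complex module over the Clifford
algebra. -/
structure IsSpinorModule (γ : Cl n →ₐ[ℝ] Module.End ℂ V) : Prop where
  nontrivial : Nontrivial V
  eq_bot_or_eq_top : ∀ W : Submodule ℂ V, (∀ a, ∀ w ∈ W, γ a w ∈ W) → W = ⊥ ∨ W = ⊤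

/-- `∑ᵢ ∂²/∂xᵢ²` on complex polynomials in `n` variables. -/
def laplacian (n : ℕ) : Module.End ℂ (MvPolynomial (Fin n) ℂ) :=
  ∑ i, (MvPolynomial.pderiv i).toLinearMap ∘ₗ (MvPolynomial.pderiv i).toLinearMap

/-- `H^q`: the harmonic homogeneous polynomials of degree `q`. -/
def harmonic (n q : ℕ) : Submodule ℂ (MvPolynomial (Fin n) ℂ) :=
  MvPolynomial.homogeneousSubmodule (Fin n) ℂ q ⊓ LinearMap.ker (laplacian n)

/-- `H^q ⊗ V` as a subspace of the space of all `V`-valued polynomials. -/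
def harmonicTensor (n q : ℕ) (V : Type*) [AddCommGroup V] [Module ℂ V] :
    Submodule ℂ (MvPolynomial (Fin n) ℂ ⊗[ℂ] V) :=
  LinearMap.range ((harmonic n q).subtype.rTensor V)

/-- Clifford multiplication `x = ∑ xᵢ eᵢ` on spinor-valued polynomials. -/
def cliffordX (γ : Cl n →ₐ[ℝ] Module.End ℂ V) : Module.End ℂ (MvPolynomial (Fin n) ℂ ⊗[ℂ] V) :=
  ∑ i, TensorProduct.map (LinearMap.mulLeft ℂ (MvPolynomial.X i)) (γ (e i))

/-- The Dirac operator `D = ∑ eᵢ ∂/∂xᵢ` on spinor-valued polynomials. -/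
def dirac (γ : Cl n →ₐ[ℝ] Module.End ℂ V) : Module.End ℂ (MvPolynomial (Fin n) ℂ ⊗[ℂ] V) :=
  ∑ i, TensorProduct.map (MvPolynomial.pderiv i).toLinearMap (γ (e i))

/-- The action of `spin(n)` on spinor-valued polynomials. -/
def spinorPolyRep (γ : Cl n →ₐ[ℝ] Module.End ℂ V) : SpinRep n (MvPolynomial (Fin n) ℂ ⊗[ℂ] V) :=
  tensorRep (polyRep n) (spinorRep γ)

/-- `H^q ⊗ V = W₀ ⊕ W₁`, where `W₀` is irreducible with highest weight `(q + 1/2, 1/2, …, 1/2)` and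
`W₁` is irreducible with highest weight `(q - 1/2, 1/2, …, 1/2)`. For `q = 0` the latter weight is
not dominant, and the second component is absent. -/
structure IsSpinorDecomposition {m : ℕ} (γ : Cl (2 * m + 1) →ₐ[ℝ] Module.End ℂ V) (q : ℕ)
    (W₀ W₁ : Submodule ℂ (MvPolynomial (Fin (2 * m + 1)) ℂ ⊗[ℂ] V)) : Prop where
  irrep₀ : IsIrrepOfHighestWeight (spinorPolyRep γ) (wtHook m (q + 1 / 2)) W₀
  irrep₁ : 1 ≤ q → IsIrrepOfHighestWeight (spinorPolyRep γ) (wtHook m (q - 1 / 2)) W₁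
  absent : q = 0 → W₁ = ⊥
  disjoint : Disjoint W₀ W₁
  sup_eq : W₀ ⊔ W₁ = harmonicTensor (2 * m + 1) q V

end

end SpinorHarmonic

/-!
The operators `x` and `D` commute with the rotations and satisfy `D x + x D = -2E - n`, with `E`
the Euler operator. If `f` is harmonic of degree `q`, then `D f` is in the kernel of `D` since
`D² = -Δ`, and it follows that `D` annihilates `x D f + (n + 2q - 2) f`. The harmonic spinors of
degree `q` are therefore the sum of `M_q` and `x M_{q-1}`, with `M_q` the kernel of `D` in degree
`q`.

Each `M_q` is irreducible. Let `w` and `w'` span a hyperbolic plane of isotropic vectors, and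
regard `w` also as a linear form. The infinitesimal rotations in the planes of `w` and the vectors
orthogonal to the hyperbolic plane annihilate a nonzero element of every nonzero invariant subspace
of `M_q`; the Dirac equation forces this element to be `w^q y` with `w y = 0`, and the
irreducibility of the spinors then puts all such polynomials in the subspace. The annihilator of
the subspace for the Fischer pairing, if nonzero, would similarly contain some `w'^q φ`, which
pairs to zero with all `w^q y` only if `φ = 0`.

As `w^q y` also gives the weight, the highest weight of an irreducible space determines which `M_p`
it can be mapped to. In an arbitrary decomposition `D` therefore vanishes on the first summand and
`x D + (n + 2q - 2)` on the second.
-/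

namespace SpinorHarmonic

noncomputable section

/-! ### The operator calculus of the Dirac operator -/

section Operators

variable {𝕜 ι F : Type*} [CommRing 𝕜] [Fintype ι] [AddCommGroup F] [Module 𝕜 F]

/-- A linear map sending vectors to operators that satisfy the Clifford relations of the negative
definite form, `(g u)² = -(u ⬝ᵥ u)`. -/
def IsCliffordMap (g : (ι → 𝕜) →ₗ[𝕜] Module.End 𝕜 F) : Prop :=
  ∀ u f, g u (g u f) = -(u ⬝ᵥ u) • f

namespace IsCliffordMap

variable {g : (ι → 𝕜) →ₗ[𝕜] Module.End 𝕜 F} (h : IsCliffordMap g) {u v : ι → 𝕜}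
include h

theorem apply_apply (u v : ι → 𝕜) (f : F) :
    g u (g v f) = -g v (g u f) - (2 * (u ⬝ᵥ v)) • f := by
  have huv := h (u + v) f
  simp only [map_add, LinearMap.add_apply, h u, h v, add_dotProduct, dotProduct_add,
    dotProduct_comm v u] at huv
  linear_combination (norm := module) huv

theorem anticomm (huv : u ⬝ᵥ v = 0) (f : F) : g u (g v f) = -g v (g u f) := by
  rw [h.apply_apply, huv, mul_zero, zero_smul, sub_zero]

theorem apply_self_of_isotropic (hu : u ⬝ᵥ u = 0) (f : F) : g u (g u f) = 0 := by
  rw [h, hu, neg_zero, zero_smul]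

end IsCliffordMap

/-- Linear families of operators satisfying the relations of multiplication by linear forms,
directional derivatives, and Clifford multiplication. -/
structure WeylClifford (X d G : (ι → 𝕜) →ₗ[𝕜] Module.End 𝕜 F) : Prop where
  X_X : ∀ u v f, X u (X v f) = X v (X u f)
  d_d : ∀ u v f, d u (d v f) = d v (d u f)
  d_X : ∀ u v f, d u (X v f) = X v (d u f) + (u ⬝ᵥ v) • f
  G_X : ∀ u v f, G u (X v f) = X v (G u f)
  G_d : ∀ u v f, G u (d v f) = d v (G u f)
  isCliffordMap : IsCliffordMap G

/-- The infinitesimal rotation `4 (v ∂_u - u ∂_v) + [u, v]` of the plane of `u` and `v`, through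
which `[u, v]` acts on spinor-valued functions. -/
def rotOp (X d G : (ι → 𝕜) →ₗ[𝕜] Module.End 𝕜 F) (u v : ι → 𝕜) : Module.End 𝕜 F :=
  (4 : 𝕜) • (X v * d u - X u * d v) + (G u * G v - G v * G u)

/-- The infinitesimal rotation of the plane of `u` and `v` acting on vectors, with the
normalization of `rotOp`. -/
def rotVec (u v x : ι → 𝕜) : ι → 𝕜 := (4 : 𝕜) • ((u ⬝ᵥ x) • v - (v ⬝ᵥ x) • u)

variable {X d G : (ι → 𝕜) →ₗ[𝕜] Module.End 𝕜 F}

omit [Fintype ι] in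
theorem rotOp_apply (u v : ι → 𝕜) (f : F) : rotOp X d G u v f =
    (4 : 𝕜) • (X v (d u f) - X u (d v f)) + (G u (G v f) - G v (G u f)) := by
  simp [rotOp]

namespace WeylClifford

variable (h : WeylClifford X d G)
include h

theorem rotOp_X (u v x : ι → 𝕜) (f : F) :
    rotOp X d G u v (X x f) = X x (rotOp X d G u v f) + X (rotVec u v x) f := by
  simp only [rotOp_apply, rotVec, h.d_X, h.G_X, h.X_X _ x, map_add, map_sub, map_smul,
    LinearMap.sub_apply, LinearMap.smul_apply]
  module

theorem rotOp_d (u v x : ι → 𝕜) (f : F) :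
    rotOp X d G u v (d x f) = d x (rotOp X d G u v f) + d (rotVec u v x) f := by
  simp only [rotOp_apply, rotVec, h.d_X, h.d_d _ x, h.G_d, map_add, map_sub, map_smul,
    LinearMap.sub_apply, LinearMap.smul_apply, dotProduct_comm x]
  module

theorem rotOp_G (u v x : ι → 𝕜) (f : F) :
    rotOp X d G u v (G x f) = G x (rotOp X d G u v f) + G (rotVec u v x) f := by
  simp only [rotOp_apply, rotVec, ← h.G_X, ← h.G_d, h.isCliffordMap.apply_apply _ x, map_add,
    map_neg, map_sub, map_smul, LinearMap.sub_apply, LinearMap.smul_apply]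
  module

theorem G_pow_X (u x : ι → 𝕜) (q : ℕ) (f : F) : G u ((X x ^ q) f) = (X x ^ q) (G u f) := by
  induction q with
  | zero => simp
  | succ q ih => rw [pow_succ', Module.End.mul_apply, h.G_X, ih, Module.End.mul_apply]

theorem d_pow_succ_X (u x : ι → 𝕜) (q : ℕ) (f : F) : d u ((X x ^ (q + 1)) f) =
    (X x ^ (q + 1)) (d u f) + ((q + 1) * (u ⬝ᵥ x)) • (X x ^ q) f := by
  induction q with
  | zero => simp [h.d_X]
  | succ q ih =>
    rw [pow_succ', Module.End.mul_apply, h.d_X, ih, map_add, map_smul, ← Module.End.mul_apply (X x),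
      ← Module.End.mul_apply (X x), ← pow_succ', ← pow_succ']
    push_cast
    module

theorem d_pow_X_pow {u : ι → 𝕜} {f : F} (hf : d u f = 0) (x : ι → 𝕜) (q : ℕ) :
    (d u ^ q) ((X x ^ q) f) = (q.factorial * (u ⬝ᵥ x) ^ q) • f := by
  induction q with
  | zero => simp
  | succ q ih =>
    rw [pow_succ (d u), Module.End.mul_apply, h.d_pow_succ_X, hf, map_zero, zero_add, map_smul, ih,
      smul_smul, Nat.factorial_succ]
    push_cast
    congr 1
    ring

theorem rotOp_pow_X {u v x : ι → 𝕜} {c : 𝕜} (hx : rotVec u v x = c • x) (q : ℕ) (f : F) :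
    rotOp X d G u v ((X x ^ q) f) =
      (X x ^ q) (rotOp X d G u v f) + (q * c) • (X x ^ q) f := by
  induction q with
  | zero => simp
  | succ q ih =>
    rw [pow_succ', Module.End.mul_apply, h.rotOp_X, ih, hx, map_add, map_smul, map_smul,
      LinearMap.smul_apply, Module.End.mul_apply]
    push_cast
    module

end WeylClifford

section Basis

variable [DecidableEq ι]

theorem sum_smul_apply_single (T : (ι → 𝕜) →ₗ[𝕜] Module.End 𝕜 F) (u : ι → 𝕜) (f : F) :
    ∑ i, u i • T (Pi.single i 1) f = T u f := by
  conv_rhs => rw [pi_eq_sum_univ' u]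
  simp

theorem sum_sum_mul_smul_apply_apply (S T : (ι → 𝕜) →ₗ[𝕜] Module.End 𝕜 F) (u v : ι → 𝕜) (f : F) :
    ∑ k, ∑ l, (u k * v l) • S (Pi.single k 1) (T (Pi.single l 1) f) = S u (T v f) := by
  rw [← sum_smul_apply_single S, ← sum_smul_apply_single T]
  simp only [map_sum, map_smul, Finset.smul_sum, mul_smul]

/-- The Laplacian `∑ ∂ᵢ²`. -/
def lapOp (d : (ι → 𝕜) →ₗ[𝕜] Module.End 𝕜 F) : Module.End 𝕜 F :=
  ∑ i, d (Pi.single i 1) * d (Pi.single i 1)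

/-- The Dirac operator `∑ eᵢ ∂ᵢ`. -/
def diracOp (d G : (ι → 𝕜) →ₗ[𝕜] Module.End 𝕜 F) : Module.End 𝕜 F :=
  ∑ i, G (Pi.single i 1) * d (Pi.single i 1)

/-- Clifford multiplication `∑ xᵢ eᵢ` by the vector variable. -/
def vecOp (X G : (ι → 𝕜) →ₗ[𝕜] Module.End 𝕜 F) : Module.End 𝕜 F :=
  ∑ i, X (Pi.single i 1) * G (Pi.single i 1)

/-- The Euler operator `∑ xᵢ ∂ᵢ`, whose eigenvalues are the degrees. -/
def eulerOp (X d : (ι → 𝕜) →ₗ[𝕜] Module.End 𝕜 F) : Module.End 𝕜 F :=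
  ∑ i, X (Pi.single i 1) * d (Pi.single i 1)

theorem lapOp_apply (f : F) : lapOp d f = ∑ i, d (Pi.single i 1) (d (Pi.single i 1) f) := by
  simp [lapOp]

theorem diracOp_apply (f : F) :
    diracOp d G f = ∑ i, G (Pi.single i 1) (d (Pi.single i 1) f) := by
  simp [diracOp]

theorem vecOp_apply (f : F) : vecOp X G f = ∑ i, X (Pi.single i 1) (G (Pi.single i 1) f) := by
  simp [vecOp]

theorem eulerOp_apply (f : F) : eulerOp X d f = ∑ i, X (Pi.single i 1) (d (Pi.single i 1) f) := by
  simp [eulerOp]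

namespace WeylClifford

variable (h : WeylClifford X d G)
include h

theorem dirac_X (u : ι → 𝕜) (f : F) : diracOp d G (X u f) = X u (diracOp d G f) + G u f := by
  simp only [diracOp_apply, h.d_X, single_one_dotProduct, map_add, map_smul, map_sum,
    Finset.sum_add_distrib, sum_smul_apply_single, h.G_X]

theorem dirac_d (u : ι → 𝕜) (f : F) : diracOp d G (d u f) = d u (diracOp d G f) := by
  simp only [diracOp_apply, h.d_d _ u, h.G_d, map_sum]

theorem dirac_G (u : ι → 𝕜) (f : F) :
    diracOp d G (G u f) = -G u (diracOp d G f) - (2 : 𝕜) • d u f := by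
  simp only [diracOp_apply, ← h.G_d, h.isCliffordMap.apply_apply _ u, single_one_dotProduct,
    mul_smul, Finset.sum_sub_distrib, Finset.sum_neg_distrib, map_sum, ← Finset.smul_sum,
    sum_smul_apply_single]

theorem vec_X (u : ι → 𝕜) (f : F) : vecOp X G (X u f) = X u (vecOp X G f) := by
  simp only [vecOp_apply, h.X_X _ u, h.G_X, map_sum]

theorem vec_d (u : ι → 𝕜) (f : F) : vecOp X G (d u f) = d u (vecOp X G f) - G u f := by
  simp only [vecOp_apply, h.d_X, h.G_d, dotProduct_single_one, Finset.sum_add_distrib, map_sum,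
    sum_smul_apply_single, add_sub_cancel_right]

theorem vec_G (u : ι → 𝕜) (f : F) :
    vecOp X G (G u f) = -G u (vecOp X G f) - (2 : 𝕜) • X u f := by
  simp only [vecOp_apply, h.isCliffordMap.apply_apply _ u, single_one_dotProduct, h.G_X, mul_smul,
    map_sub, map_neg, map_smul, map_sum, Finset.sum_sub_distrib, Finset.sum_neg_distrib,
    ← Finset.smul_sum, sum_smul_apply_single]

theorem euler_X (u : ι → 𝕜) (f : F) : eulerOp X d (X u f) = X u (eulerOp X d f) + X u f := by
  simp only [eulerOp_apply, h.d_X, single_one_dotProduct, h.X_X _ u, map_add, map_smul, map_sum,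
    Finset.sum_add_distrib, sum_smul_apply_single]

theorem euler_d (u : ι → 𝕜) (f : F) : eulerOp X d (d u f) = d u (eulerOp X d f) - d u f := by
  simp only [eulerOp_apply, h.d_X, dotProduct_single_one, h.d_d _ u, map_sum,
    Finset.sum_add_distrib, sum_smul_apply_single, add_sub_cancel_right]

theorem euler_G (u : ι → 𝕜) (f : F) : eulerOp X d (G u f) = G u (eulerOp X d f) := by
  simp only [eulerOp_apply, h.G_d, h.G_X, map_sum]

theorem dirac_rot (u v : ι → 𝕜) (f : F) :
    diracOp d G (rotOp X d G u v f) = rotOp X d G u v (diracOp d G f) := by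
  simp only [rotOp_apply, map_add, map_sub, map_smul, h.dirac_X, h.dirac_d, h.dirac_G, map_neg,
    h.G_d]
  module

theorem vec_rot (u v : ι → 𝕜) (f : F) :
    vecOp X G (rotOp X d G u v f) = rotOp X d G u v (vecOp X G f) := by
  simp only [rotOp_apply, map_add, map_sub, map_smul, h.vec_X, h.vec_d, h.vec_G, map_neg,
    h.G_X]
  module

theorem euler_rot (u v : ι → 𝕜) (f : F) :
    eulerOp X d (rotOp X d G u v f) = rotOp X d G u v (eulerOp X d f) := by
  simp only [rotOp_apply, map_add, map_sub, map_smul, h.euler_X, h.euler_d, h.euler_G]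
  module

theorem euler_dirac (f : F) :
    eulerOp X d (diracOp d G f) = diracOp d G (eulerOp X d f) - diracOp d G f := by
  conv_lhs => rw [diracOp_apply]
  simp only [map_sum, h.euler_d, h.euler_G, map_sub]
  rw [Finset.sum_sub_distrib, ← diracOp_apply, ← diracOp_apply]

theorem euler_vec (f : F) :
    eulerOp X d (vecOp X G f) = vecOp X G (eulerOp X d f) + vecOp X G f := by
  conv_lhs => rw [vecOp_apply]
  simp only [map_sum, h.euler_X, h.euler_G]
  rw [Finset.sum_add_distrib, ← vecOp_apply, ← vecOp_apply]

theorem dirac_vec (f : F) : diracOp d G (vecOp X G f) =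
    -vecOp X G (diracOp d G f) - (2 : 𝕜) • eulerOp X d f - (Fintype.card ι : 𝕜) • f := by
  have hG (i : ι) (f : F) : G (Pi.single i 1) (G (Pi.single i 1) f) = -f := by
    rw [h.isCliffordMap]; simp
  conv_lhs => rw [vecOp_apply]
  simp only [map_sum, h.dirac_X, h.dirac_G, hG, map_sub, map_neg, map_smul]
  rw [Finset.sum_add_distrib, Finset.sum_sub_distrib, Finset.sum_neg_distrib, ← vecOp_apply,
    ← Finset.smul_sum, ← eulerOp_apply, Finset.sum_neg_distrib, Finset.sum_const,
    Finset.card_univ, ← Nat.cast_smul_eq_nsmul 𝕜, ← sub_eq_add_neg]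

theorem dirac_vec_vec (f : F) : diracOp d G (vecOp X G (vecOp X G f)) =
    vecOp X G (vecOp X G (diracOp d G f)) - (2 : 𝕜) • vecOp X G f := by
  simp only [h.dirac_vec, h.euler_vec, map_sub, map_neg, map_smul]
  module

theorem euler_vec_of_eq {f : F} {c : 𝕜} (hf : eulerOp X d f = c • f) :
    eulerOp X d (vecOp X G f) = (c + 1) • vecOp X G f := by
  rw [h.euler_vec, hf, map_smul]; module

theorem euler_dirac_of_eq {f : F} {c : 𝕜} (hf : eulerOp X d f = c • f) :
    eulerOp X d (diracOp d G f) = (c - 1) • diracOp d G f := by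
  rw [h.euler_dirac, hf, map_smul]; module

theorem two_smul_dirac_dirac (f : F) :
    (2 : 𝕜) • diracOp d G (diracOp d G f) = -(2 : 𝕜) • lapOp d f := by
  have hD : diracOp d G (diracOp d G f) =
      -diracOp d G (diracOp d G f) - (2 : 𝕜) • lapOp d f := by
    conv_lhs => rw [diracOp_apply (f := f)]
    simp only [map_sum, h.dirac_G, h.dirac_d]
    rw [Finset.sum_sub_distrib, Finset.sum_neg_distrib, ← diracOp_apply, ← Finset.smul_sum,
      lapOp_apply]
  linear_combination (norm := module) hD

end WeylClifford

end Basis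

end Operators

section WittFrames

variable {𝕜 ι F : Type*} [Field 𝕜] [Fintype ι] [DecidableEq ι] [AddCommGroup F] [Module 𝕜 F]

/-- A basis of `ι → 𝕜` adapted to a hyperbolic plane: isotropic vectors `w` and `w'` with
`w ⬝ᵥ w' = 2`, completed by the standard basis vectors with index in `s`. For `s` the complement
of `{a, b}` and `i ^ 2 = -1`, the vectors `e_a - i e_b` and `e_a + i e_b` give such a basis. -/
structure WittFrame (w w' : ι → 𝕜) (s : Finset ι) : Prop where
  dot_self_left : w ⬝ᵥ w = 0
  dot_self_right : w' ⬝ᵥ w' = 0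
  dot : w ⬝ᵥ w' = 2
  left_apply : ∀ k ∈ s, w k = 0
  right_apply : ∀ k ∈ s, w' k = 0
  two_smul_eq : ∀ u : ι → 𝕜, (2 : 𝕜) • u =
    (w' ⬝ᵥ u) • w + (w ⬝ᵥ u) • w' + (2 : 𝕜) • ∑ k ∈ s, u k • Pi.single k 1

/-- The operator `w ∂_{w'} + ∑ₖ xₖ ∂ₖ`. For a Witt frame it has eigenvalue `2` on the linear form
`w`, `1` on `xₖ` for `k ∈ s`, and `0` on `w'`. -/
def depthOp (X d : (ι → 𝕜) →ₗ[𝕜] Module.End 𝕜 F) (w w' : ι → 𝕜) (s : Finset ι) :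
    Module.End 𝕜 F :=
  X w * d w' + ∑ k ∈ s, X (Pi.single k 1) * d (Pi.single k 1)

variable {X d G : (ι → 𝕜) →ₗ[𝕜] Module.End 𝕜 F} {w w' : ι → 𝕜} {s : Finset ι}

omit [Fintype ι] in
theorem depthOp_apply (f : F) : depthOp X d w w' s f =
    X w (d w' f) + ∑ k ∈ s, X (Pi.single k 1) (d (Pi.single k 1) f) := by
  simp [depthOp]

omit [Fintype ι] [DecidableEq ι] in
theorem eq_zero_of_not_hasEigenvalue {T : Module.End 𝕜 F} {μ : 𝕜} (hT : ¬ T.HasEigenvalue μ)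
    {f : F} (hf : T f = μ • f) : f = 0 := by
  by_contra hf0
  exact hT (Module.End.hasEigenvalue_of_hasEigenvector
    ⟨Module.End.mem_eigenspace_iff.2 hf, hf0⟩)

namespace WittFrame

variable (fr : WittFrame w w' s)
include fr

theorem symm : WittFrame w' w s where
  dot_self_left := fr.dot_self_right
  dot_self_right := fr.dot_self_left
  dot := by rw [dotProduct_comm, fr.dot]
  left_apply := fr.right_apply
  right_apply := fr.left_apply
  two_smul_eq u := by rw [fr.two_smul_eq]; abel

theorem left_ne_zero [NeZero (2 : 𝕜)] : w ≠ 0 := by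
  rintro rfl
  exact two_ne_zero (α := 𝕜) (by rw [← fr.dot, zero_dotProduct])

theorem rotVec_left : rotVec w w' w = (-8 : 𝕜) • w := by
  rw [rotVec, fr.dot_self_left, dotProduct_comm, fr.dot]; module

theorem rotVec_right : rotVec w w' w' = (8 : 𝕜) • w' := by
  rw [rotVec, fr.dot_self_right, fr.dot]; module

theorem rotVec_single {k : ι} (hk : k ∈ s) : rotVec w w' (Pi.single k 1) = 0 := by
  simp [rotVec, fr.left_apply k hk, fr.right_apply k hk]

/-- The resolution of the identity in a Witt frame. -/
theorem two_smul_sum_apply (S T : (ι → 𝕜) →ₗ[𝕜] Module.End 𝕜 F) (f : F) :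
    (2 : 𝕜) • ∑ i, S (Pi.single i 1) (T (Pi.single i 1) f) =
      S w (T w' f) + S w' (T w f) +
        (2 : 𝕜) • ∑ k ∈ s, S (Pi.single k 1) (T (Pi.single k 1) f) := by
  have hT (i : ι) : (2 : 𝕜) • T (Pi.single i 1) f =
      w' i • T w f + w i • T w' f +
        (2 : 𝕜) • ∑ k ∈ s, (Pi.single i 1 : ι → 𝕜) k • T (Pi.single k 1) f := by
    have := congrArg (fun u => T u f) (fr.two_smul_eq (Pi.single i 1))
    simpa using this
  have hS (k : ι) : ∑ i, (Pi.single i 1 : ι → 𝕜) k • S (Pi.single i 1) (T (Pi.single k 1) f) =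
      S (Pi.single k 1) (T (Pi.single k 1) f) := by
    simp [Pi.single_apply]
  rw [Finset.smul_sum]
  simp only [← map_smul, hT]
  simp only [map_add, map_smul, map_sum, Finset.sum_add_distrib, sum_smul_apply_single,
    ← Finset.smul_sum]
  rw [Finset.sum_comm, Finset.sum_congr rfl fun k _ => hS k]
  abel

theorem two_smul_diracOp (f : F) : (2 : 𝕜) • diracOp d G f =
    G w (d w' f) + G w' (d w f) + (2 : 𝕜) • ∑ k ∈ s, G (Pi.single k 1) (d (Pi.single k 1) f) := by
  rw [diracOp_apply, fr.two_smul_sum_apply]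

theorem two_smul_eulerOp (f : F) : (2 : 𝕜) • eulerOp X d f =
    X w (d w' f) + X w' (d w f) + (2 : 𝕜) • ∑ k ∈ s, X (Pi.single k 1) (d (Pi.single k 1) f) := by
  rw [eulerOp_apply, fr.two_smul_sum_apply]

end WittFrame

namespace WeylClifford

variable (h : WeylClifford X d G)
include h

omit [DecidableEq ι] in
theorem rotOp_rotOp (u v x y : ι → 𝕜) (f : F) : rotOp X d G u v (rotOp X d G x y f) =
    rotOp X d G x y (rotOp X d G u v f) + rotOp X d G (rotVec u v x) y f +
      rotOp X d G x (rotVec u v y) f := by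
  rw [rotOp_apply (X := X) (d := d) (G := G) x y f]
  simp only [map_add, map_sub, map_smul, h.rotOp_X, h.rotOp_d, h.rotOp_G]
  simp only [rotOp_apply x y, rotOp_apply (rotVec u v x) y, rotOp_apply x (rotVec u v y)]
  module

theorem lap_G (u : ι → 𝕜) (f : F) : lapOp d (G u f) = G u (lapOp d f) := by
  simp only [lapOp_apply, map_sum, h.G_d]

end WeylClifford

section Extremal

variable (h : WeylClifford X d G) (fr : WittFrame w w' s)
include h fr

theorem WeylClifford.rotOp_single_apply {k : ι} (hk : k ∈ s) (f : F) :
    rotOp X d G w (Pi.single k 1) f =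
      (4 : 𝕜) • (X (Pi.single k 1) (d w f) - X w (d (Pi.single k 1) f)) -
        (2 : 𝕜) • G (Pi.single k 1) (G w f) := by
  rw [rotOp_apply, h.isCliffordMap.anticomm (u := w)]
  · module
  · rw [dotProduct_single_one, fr.left_apply k hk]

variable [CharZero 𝕜] (hX : Function.Injective (X w))
  (hN : ¬ (depthOp X d w w' s).HasEigenvalue (-(s.card : 𝕜)))
include hX hN

theorem WeylClifford.d_eq_zero_of_lap_eq_zero {g : F} (hg : lapOp d g = 0)
    (hrot : ∀ k ∈ s, X (Pi.single k 1) (d w g) = X w (d (Pi.single k 1) g)) :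
    d w g = 0 ∧ ∀ k ∈ s, d (Pi.single k 1) g = 0 := by
  have hlap : d w' (d w g) + ∑ k ∈ s, d (Pi.single k 1) (d (Pi.single k 1) g) = 0 := by
    have h2 := fr.two_smul_sum_apply d d g
    rw [← lapOp_apply, hg, smul_zero, h.d_d w] at h2
    refine (smul_eq_zero (r := (2 : 𝕜)).1 ?_).resolve_left two_ne_zero
    linear_combination (norm := module) -h2
  have hterm : ∀ k ∈ s, X w (d (Pi.single k 1) (d (Pi.single k 1) g)) =
      X (Pi.single k 1) (d (Pi.single k 1) (d w g)) + d w g := fun k hk => by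
    have hdX := h.d_X (Pi.single k 1) w (d (Pi.single k 1) g)
    rw [single_one_dotProduct, fr.left_apply k hk, zero_smul, add_zero, ← hrot k hk, h.d_X] at hdX
    simpa using hdX.symm
  have hdw : d w g = 0 := by
    refine eq_zero_of_not_hasEigenvalue hN ?_
    have hXw := congrArg (X w) hlap
    rw [map_add, map_sum, Finset.sum_congr rfl hterm, Finset.sum_add_distrib, Finset.sum_const,
      map_zero, ← Nat.cast_smul_eq_nsmul 𝕜, ← add_assoc, ← depthOp_apply] at hXw
    rw [neg_smul, eq_neg_of_add_eq_zero_left hXw]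
  exact ⟨hdw, fun k hk => (map_eq_zero_iff _ hX).1 (by rw [← hrot k hk, hdw, map_zero])⟩

variable {f : F} (hD : diracOp d G f = 0)
  (hrot : ∀ k ∈ s, rotOp X d G w (Pi.single k 1) f = 0)
include hD hrot

omit hX hN hD in
theorem WeylClifford.G_single_G_of_rotOp_eq_zero {k : ι} (hk : k ∈ s) :
    G (Pi.single k 1) (G w f) =
      (2 : 𝕜) • (X (Pi.single k 1) (d w f) - X w (d (Pi.single k 1) f)) := by
  have hk0 := hrot k hk
  rw [h.rotOp_single_apply fr hk] at hk0
  refine smul_right_injective F (two_ne_zero (α := 𝕜)) ?_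
  linear_combination (norm := module) -hk0

theorem WeylClifford.d_G_eq_zero_of_rotOp_eq_zero :
    d w (G w f) = 0 ∧ ∀ k ∈ s, d (Pi.single k 1) (G w f) = 0 := by
  refine h.d_eq_zero_of_lap_eq_zero fr hX hN ?_ fun k hk => ?_
  · have hlap := h.two_smul_dirac_dirac f
    rw [hD, map_zero, smul_zero] at hlap
    rw [h.lap_G, (smul_eq_zero.1 hlap.symm).resolve_left (by simp), map_zero]
  · have hG := congrArg (G w) (h.G_single_G_of_rotOp_eq_zero fr hrot hk)
    rw [h.isCliffordMap.anticomm (by rw [dotProduct_single_one, fr.left_apply k hk]),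
      h.isCliffordMap.apply_self_of_isotropic fr.dot_self_left, map_zero, neg_zero, map_smul,
      map_sub, h.G_X, h.G_X, h.G_d, h.G_d] at hG
    exact sub_eq_zero.1 ((smul_eq_zero.1 hG.symm).resolve_left two_ne_zero)

omit hX hN in
theorem WeylClifford.X_dirac_of_rotOp_eq_zero :
    X w (d w' (G w f)) + G w' (X w (d w f)) +
      (2 : 𝕜) • ∑ k ∈ s, X (Pi.single k 1) (G (Pi.single k 1) (d w f)) +
        (s.card : 𝕜) • G w f = 0 := by
  have hterm : ∀ k ∈ s, (2 : 𝕜) • X w (G (Pi.single k 1) (d (Pi.single k 1) f)) =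
      (2 : 𝕜) • X (Pi.single k 1) (G (Pi.single k 1) (d w f)) + G w f := fun k hk => by
    have hG := congrArg (G (Pi.single k 1)) (h.G_single_G_of_rotOp_eq_zero fr hrot hk)
    rw [h.isCliffordMap, dotProduct_single_one, Pi.single_eq_same, map_smul, map_sub, h.G_X,
      h.G_X] at hG
    linear_combination (norm := module) hG
  have hX := congrArg (X w) (fr.two_smul_diracOp (d := d) (G := G) f)
  rw [hD, smul_zero, map_zero, map_add, map_add, map_smul, map_sum, Finset.smul_sum,
    Finset.sum_congr rfl hterm, Finset.sum_add_distrib, Finset.sum_const, ← Finset.smul_sum,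
    ← Nat.cast_smul_eq_nsmul 𝕜, h.G_d, ← h.G_X w', ← add_assoc] at hX
  exact hX.symm

theorem WeylClifford.d_left_eq_zero_of_rotOp_eq_zero : d w f = 0 := by
  have hdG := (h.d_G_eq_zero_of_rotOp_eq_zero fr hX hN hD hrot).1
  have hGd : G w (d w f) = 0 := by rw [h.G_d, hdG]
  have hGG : G w (G w f) = 0 := h.isCliffordMap.apply_self_of_isotropic fr.dot_self_left f
  have hsum : ∀ k ∈ s, G w (X (Pi.single k 1) (G (Pi.single k 1) (d w f))) = 0 := fun k hk => by
    rw [h.G_X, h.isCliffordMap.anticomm (by rw [dotProduct_single_one, fr.left_apply k hk]), hGd,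
      map_zero, neg_zero, map_zero]
  have hG := congrArg (G w) (h.X_dirac_of_rotOp_eq_zero fr hD hrot)
  rw [map_add, map_add, map_add, map_smul, map_smul, map_sum, Finset.sum_eq_zero hsum, hGG, h.G_X,
    h.G_d, hGG, h.isCliffordMap.apply_apply, h.G_X, hGd, fr.dot] at hG
  simp only [map_zero, smul_zero, neg_zero, zero_sub, zero_add, add_zero, neg_eq_zero] at hG
  exact (map_eq_zero_iff _ hX).1 ((smul_eq_zero.1 hG).resolve_left (by norm_num))

theorem WeylClifford.G_left_eq_zero_of_rotOp_eq_zero : G w f = 0 := by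
  have hdw := h.d_left_eq_zero_of_rotOp_eq_zero fr hX hN hD hrot
  have hdG := (h.d_G_eq_zero_of_rotOp_eq_zero fr hX hN hD hrot).2
  have hdepth := h.X_dirac_of_rotOp_eq_zero fr hD hrot
  simp only [hdw, map_zero, Finset.sum_const_zero, smul_zero, add_zero] at hdepth
  refine eq_zero_of_not_hasEigenvalue hN ?_
  rw [depthOp_apply, Finset.sum_eq_zero fun k hk => by rw [hdG k hk, map_zero], add_zero, neg_smul,
    eq_neg_of_add_eq_zero_left hdepth]

theorem WeylClifford.d_single_eq_zero_of_rotOp_eq_zero {k : ι} (hk : k ∈ s) :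
    d (Pi.single k 1) f = 0 := by
  have hG := h.G_single_G_of_rotOp_eq_zero fr hrot hk
  rw [h.G_left_eq_zero_of_rotOp_eq_zero fr hX hN hD hrot,
    h.d_left_eq_zero_of_rotOp_eq_zero fr hX hN hD hrot, map_zero, map_zero, zero_sub, smul_neg,
    zero_eq_neg] at hG
  exact (map_eq_zero_iff _ hX).1 ((smul_eq_zero.1 hG).resolve_left two_ne_zero)

end Extremal

end WittFrames

section Fischer

variable {𝕜 ι F : Type*} [CommRing 𝕜] [Fintype ι] [DecidableEq ι] [AddCommGroup F] [Module 𝕜 F]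
  {X d G : (ι → 𝕜) →ₗ[𝕜] Module.End 𝕜 F}

/-- The monogenic functions of degree `q`: the solutions of the Dirac equation that are
homogeneous of degree `q`. -/
def monogenic (X d G : (ι → 𝕜) →ₗ[𝕜] Module.End 𝕜 F) (q : ℕ) : Submodule 𝕜 F :=
  LinearMap.ker (diracOp d G) ⊓ (eulerOp X d).eigenspace (q : 𝕜)

/-- The sum of the spaces `xʲ M_p`, with `M_p` the monogenic functions of degree `p`, for
`j + p = q`. -/
def fischerSum (X d G : (ι → 𝕜) →ₗ[𝕜] Module.End 𝕜 F) (q : ℕ) : Submodule 𝕜 F :=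
  ⨆ (j : ℕ) (p : ℕ) (_ : j + p = q), (monogenic X d G p).map (vecOp X G ^ j)

theorem mem_monogenic {q : ℕ} {f : F} :
    f ∈ monogenic X d G q ↔ diracOp d G f = 0 ∧ eulerOp X d f = (q : 𝕜) • f := by
  rw [monogenic, Submodule.mem_inf, LinearMap.mem_ker, Module.End.mem_eigenspace_iff]

theorem vec_pow_mem_fischerSum {q p : ℕ} {f : F} (hf : f ∈ monogenic X d G p) (j : ℕ)
    (hj : j + p = q) : (vecOp X G ^ j) f ∈ fischerSum X d G q :=
  Submodule.mem_iSup_of_mem j <| Submodule.mem_iSup_of_mem p <| Submodule.mem_iSup_of_mem hj <|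
    Submodule.mem_map_of_mem hf

theorem fischerSum_le {q : ℕ} {W : Submodule 𝕜 F}
    (hW : ∀ j p : ℕ, j + p = q → ∀ f ∈ monogenic X d G p, (vecOp X G ^ j) f ∈ W) :
    fischerSum X d G q ≤ W :=
  iSup_le fun j => iSup₂_le fun p hj => Submodule.map_le_iff_le_comap.2 (hW j p hj)

namespace WeylClifford

theorem map_vec_fischerSum_le (q : ℕ) :
    (fischerSum X d G q).map (vecOp X G) ≤ fischerSum X d G (q + 1) := by
  refine Submodule.map_le_iff_le_comap.2 (fischerSum_le fun j p hj f hf => ?_)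
  rw [Submodule.mem_comap, ← Module.End.mul_apply, ← pow_succ']
  exact vec_pow_mem_fischerSum hf _ (by omega)

variable (h : WeylClifford X d G)
include h

theorem X_pow_mem_monogenic {u : ι → 𝕜} {p : ℕ} {f : F} (hf : f ∈ monogenic X d G p)
    (hu : G u f = 0) (k : ℕ) : (X u ^ k) f ∈ monogenic X d G (p + k) := by
  induction k with
  | zero => exact hf
  | succ k ih =>
    obtain ⟨hD, hE⟩ := mem_monogenic.1 ih
    rw [pow_succ', Module.End.mul_apply, mem_monogenic, h.dirac_X, h.euler_X, hD, hE, h.G_pow_X,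
      hu]
    simp only [map_zero, add_zero, map_smul, true_and]
    push_cast
    module

theorem fischerSum_le_eigenspace (q : ℕ) :
    fischerSum X d G q ≤ (eulerOp X d).eigenspace (q : 𝕜) := by
  refine fischerSum_le fun j p hj f hf => Module.End.mem_eigenspace_iff.2 ?_
  subst hj
  induction j with
  | zero => simpa using (mem_monogenic.1 hf).2
  | succ j ih =>
    rw [pow_succ', Module.End.mul_apply, h.euler_vec_of_eq ih]
    push_cast
    module

theorem exists_dirac_vec_pow_eq [Nonempty ι] {p : ℕ} {f : F} (hf : f ∈ monogenic X d G p) (j : ℕ) :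
    ∃ r : ℕ, diracOp d G ((vecOp X G ^ (j + 1)) f) = (-(r + 1 : 𝕜)) • (vecOp X G ^ j) f := by
  obtain ⟨hD, hE⟩ := mem_monogenic.1 hf
  induction j using Nat.twoStepInduction with
  | zero =>
    have hcard : 0 < Fintype.card ι := Fintype.card_pos
    refine ⟨Fintype.card ι + 2 * p - 1, ?_⟩
    rw [zero_add, pow_one, h.dirac_vec, hD, hE, Nat.cast_sub (by omega), pow_zero,
      Module.End.one_apply, map_zero]
    push_cast
    module
  | one =>
    refine ⟨1, ?_⟩
    rw [pow_succ', pow_one, Module.End.mul_apply, h.dirac_vec_vec, hD, map_zero, map_zero]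
    push_cast
    module
  | more j ih _ =>
    obtain ⟨r, hr⟩ := ih
    refine ⟨r + 2, ?_⟩
    rw [pow_succ' _ (j + 2), pow_succ' _ (j + 1), Module.End.mul_apply, Module.End.mul_apply,
      h.dirac_vec_vec, hr, map_smul, map_smul, ← Module.End.mul_apply, ← Module.End.mul_apply,
      ← Module.End.mul_apply, mul_assoc, ← pow_succ', ← pow_succ']
    push_cast
    module

end WeylClifford

section Field

variable {𝕜 ι F : Type*} [Field 𝕜] [CharZero 𝕜] [Fintype ι] [Nonempty ι] [DecidableEq ι]
  [AddCommGroup F] [Module 𝕜 F] {X d G : (ι → 𝕜) →ₗ[𝕜] Module.End 𝕜 F}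

namespace WeylClifford

variable (h : WeylClifford X d G)
include h

theorem fischerSum_le_map_dirac_vec (q : ℕ) :
    fischerSum X d G q ≤ (fischerSum X d G q).map (diracOp d G * vecOp X G) := by
  refine fischerSum_le fun j p hj f hf => ?_
  obtain ⟨r, hr⟩ := h.exists_dirac_vec_pow_eq hf j
  refine ⟨(-(r + 1 : 𝕜))⁻¹ • (vecOp X G ^ j) f,
    Submodule.smul_mem _ _ (vec_pow_mem_fischerSum hf j hj), ?_⟩
  rw [map_smul, Module.End.mul_apply, ← Module.End.mul_apply (vecOp X G), ← pow_succ', hr,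
    inv_smul_smul₀ (neg_ne_zero.2 (Nat.cast_add_one_ne_zero r))]

variable (hneg : ¬ (eulerOp X d).HasEigenvalue (-1))
include hneg

theorem eigenspace_le_fischerSum (q : ℕ) :
    (eulerOp X d).eigenspace (q : 𝕜) ≤ fischerSum X d G q := by
  induction q with
  | zero =>
    intro f hf
    have hE := Module.End.mem_eigenspace_iff.1 hf
    refine vec_pow_mem_fischerSum (p := 0) (j := 0) (mem_monogenic.2 ⟨?_, hE⟩) rfl
    exact eq_zero_of_not_hasEigenvalue hneg
      (by rw [h.euler_dirac_of_eq hE, Nat.cast_zero, zero_sub])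
  | succ q ih =>
    intro f hf
    have hE := Module.End.mem_eigenspace_iff.1 hf
    have hDf : diracOp d G f ∈ fischerSum X d G q := ih <| Module.End.mem_eigenspace_iff.2 <| by
      rw [h.euler_dirac_of_eq hE, Nat.cast_succ, add_sub_cancel_right]
    obtain ⟨u, hu, hDu⟩ := h.fischerSum_le_map_dirac_vec q hDf
    have hxu : vecOp X G u ∈ fischerSum X d G (q + 1) :=
      map_vec_fischerSum_le q (Submodule.mem_map_of_mem hu)
    have hsub : f - vecOp X G u ∈ monogenic X d G (q + 1) :=
      ⟨by rw [SetLike.mem_coe, LinearMap.mem_ker, map_sub, ← hDu, Module.End.mul_apply, sub_self],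
        Submodule.sub_mem _ hf (h.fischerSum_le_eigenspace _ hxu)⟩
    rw [← sub_add_cancel f (vecOp X G u)]
    exact Submodule.add_mem _ (vec_pow_mem_fischerSum hsub 0 (zero_add _)) hxu

theorem eigenspace_le_monogenic_sup (q : ℕ) :
    (eulerOp X d).eigenspace (q : 𝕜) ≤ monogenic X d G q ⊔ LinearMap.range (vecOp X G) := by
  refine (h.eigenspace_le_fischerSum hneg q).trans (fischerSum_le fun j p hj f hf => ?_)
  rcases j with - | j
  · rw [zero_add] at hj
    exact Submodule.mem_sup_left (hj ▸ hf)
  · rw [pow_succ', Module.End.mul_apply]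
    exact Submodule.mem_sup_right (LinearMap.mem_range_self _ _)

end WeylClifford

end Field

end Fischer

section Eigenvalues

variable {𝕜 F : Type*} [Field 𝕜] [AddCommGroup F] [Module 𝕜 F]

/-- The shifts move any eigenvalue along an infinite progression, unless they annihilate an
eigenvector. -/
theorem exists_ne_zero_forall_apply_eq_zero [IsAlgClosed 𝕜] [CharZero 𝕜] {κ : Type*}
    {W : Submodule 𝕜 F} [FiniteDimensional 𝕜 W] (hW : W ≠ ⊥) {L : Module.End 𝕜 F}
    {E : κ → Module.End 𝕜 F} {c : 𝕜} (hc : c ≠ 0) (hL : ∀ w ∈ W, L w ∈ W)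
    (hE : ∀ i, ∀ w ∈ W, E i w ∈ W) (hLE : ∀ i f, L (E i f) = E i (L f) + c • E i f) :
    ∃ w ∈ W, w ≠ 0 ∧ ∀ i, E i w = 0 := by
  have : Nontrivial W := Submodule.nontrivial_iff_ne_bot.2 hW
  by_contra! hne
  let T : Module.End 𝕜 W := L.restrict hL
  obtain ⟨μ, hμ⟩ := Module.End.exists_eigenvalue T
  have hshift : ∀ k : ℕ, T.HasEigenvalue (μ + k * c) := fun k => by
    induction k with
    | zero => simpa using hμ
    | succ k ih =>
      obtain ⟨w, hw⟩ := ih.exists_hasEigenvector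
      have hLw : L w = (μ + k * c) • (w : F) := congrArg Subtype.val hw.apply_eq_smul
      obtain ⟨i, hi⟩ := hne w w.2 fun h0 => hw.2 (Subtype.ext h0)
      refine Module.End.hasEigenvalue_of_hasEigenvector (x := ⟨E i w, hE i w w.2⟩)
        ⟨Module.End.mem_eigenspace_iff.2 (Subtype.ext ?_), fun h0 => hi (congrArg Subtype.val h0)⟩
      change L (E i w) = (μ + (k + 1 : ℕ) * c) • E i (w : F)
      rw [hLE, hLw, map_smul]
      push_cast
      module
  refine Set.infinite_range_of_injective (f := fun k : ℕ => μ + k * c) ?_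
    (T.finite_hasEigenvalue.subset (Set.range_subset_iff.2 hshift))
  intro k l hkl
  simpa [hc] using hkl

theorem not_hasEigenvalue_of_iSup_eigenspace_eq_top {κ : Type*} {a : κ → 𝕜} {T : Module.End 𝕜 F}
    (hT : ⨆ k, T.eigenspace (a k) = ⊤) {μ : 𝕜} (hμ : ∀ k, a k ≠ μ) : ¬ T.HasEigenvalue μ := by
  refine fun hev => hev ?_
  have hdisj := T.eigenspaces_iSupIndep μ
  have htop : ⨆ k, T.eigenspace (a k) ≤ ⨆ (j) (_ : j ≠ μ), T.eigenspace j :=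
    iSup_le fun k => le_iSup₂_of_le (a k) (hμ k) le_rfl
  rw [hT, top_le_iff] at htop
  rwa [htop, disjoint_top] at hdisj

theorem mem_iSup_eigenspace_of_shift {T Y : Module.End 𝕜 F} (r : ℕ)
    (h : ∀ f, T (Y f) = Y (T f) + (r : 𝕜) • Y f) {f : F}
    (hf : f ∈ ⨆ k : ℕ, T.eigenspace (k : 𝕜)) : Y f ∈ ⨆ k : ℕ, T.eigenspace (k : 𝕜) := by
  suffices ⨆ k : ℕ, T.eigenspace (k : 𝕜) ≤ (⨆ k : ℕ, T.eigenspace (k : 𝕜)).comap Y from this hf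
  refine iSup_le fun k f hf => Submodule.mem_iSup_of_mem (k + r) ?_
  rw [Module.End.mem_eigenspace_iff] at hf ⊢
  rw [h, hf, map_smul]
  push_cast
  module

end Eigenvalues

section LinearForms

variable {𝕜 ι F : Type*} [Field 𝕜] [Fintype ι] [DecidableEq ι] [AddCommGroup F] [Module 𝕜 F]
  {X d G : (ι → 𝕜) →ₗ[𝕜] Module.End 𝕜 F} {w w' : ι → 𝕜} {s : Finset ι}
  (h : WeylClifford X d G)
include h

theorem WeylClifford.depth_X (u : ι → 𝕜) (f : F) : depthOp X d w w' s (X u f) =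
    X u (depthOp X d w w' s f) + (w' ⬝ᵥ u) • X w f + ∑ k ∈ s, u k • X (Pi.single k 1) f := by
  simp only [depthOp_apply, h.d_X, map_add, map_smul, map_sum, h.X_X u, single_one_dotProduct,
    Finset.sum_add_distrib]
  abel

variable (fr : WittFrame w w' s)
include fr

theorem WeylClifford.X_mem_iSup_eigenspace_depthOp [NeZero (2 : 𝕜)] (u : ι → 𝕜) {f : F}
    (hf : f ∈ ⨆ k : ℕ, (depthOp X d w w' s).eigenspace (k : 𝕜)) :
    X u f ∈ ⨆ k : ℕ, (depthOp X d w w' s).eigenspace (k : 𝕜) := by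
  have hw : X w f ∈ ⨆ k : ℕ, (depthOp X d w w' s).eigenspace (k : 𝕜) := by
    refine mem_iSup_eigenspace_of_shift 2 (fun f => ?_) hf
    rw [h.depth_X, dotProduct_comm, fr.dot,
      Finset.sum_eq_zero fun k hk => by rw [fr.left_apply k hk, zero_smul], add_zero,
      Nat.cast_ofNat]
  have hw' : X w' f ∈ ⨆ k : ℕ, (depthOp X d w w' s).eigenspace (k : 𝕜) := by
    refine mem_iSup_eigenspace_of_shift 0 (fun f => ?_) hf
    rw [h.depth_X, fr.dot_self_right, Finset.sum_eq_zero fun k hk => by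
      rw [fr.right_apply k hk, zero_smul], Nat.cast_zero, zero_smul, zero_smul, add_zero]
  have hs : ∀ k ∈ s, X (Pi.single k 1) f ∈ ⨆ k : ℕ, (depthOp X d w w' s).eigenspace (k : 𝕜) := by
    refine fun k hk => mem_iSup_eigenspace_of_shift 1 (fun f => ?_) hf
    rw [h.depth_X, dotProduct_single_one, fr.right_apply k hk, zero_smul, add_zero,
      Finset.sum_eq_single_of_mem k hk fun l _ hl => by
        rw [Pi.single_eq_of_ne hl, zero_smul], Pi.single_eq_same, Nat.cast_one]
  have hu : (2 : 𝕜) • X u f = (w' ⬝ᵥ u) • X w f + (w ⬝ᵥ u) • X w' f +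
      (2 : 𝕜) • ∑ k ∈ s, u k • X (Pi.single k 1) f := by
    have := congrArg (fun v => X v f) (fr.two_smul_eq u)
    simpa only [map_add, map_smul, map_sum, LinearMap.add_apply, LinearMap.smul_apply,
      LinearMap.sum_apply] using this
  refine (Submodule.smul_mem_iff _ (two_ne_zero (α := 𝕜))).1 (hu ▸ ?_)
  exact add_mem (add_mem (Submodule.smul_mem _ _ hw) (Submodule.smul_mem _ _ hw'))
    (Submodule.smul_mem _ _ (sum_mem fun k hk => Submodule.smul_mem _ _ (hs k hk)))

/-- Only the variable `w` remains when all derivatives other than the one along `w'` vanish. -/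
theorem WeylClifford.exists_eq_X_pow [CharZero 𝕜] {q : ℕ} {f : F}
    (hE : eulerOp X d f = (q : 𝕜) • f) (hw : d w f = 0)
    (hs : ∀ k ∈ s, d (Pi.single k 1) f = 0) :
    ∃ f₀, eulerOp X d f₀ = 0 ∧ f = (X w ^ q) f₀ := by
  induction q generalizing f with
  | zero => exact ⟨f, by simpa using hE, by simp⟩
  | succ q ih =>
    have hE' : eulerOp X d (d w' f) = (q : 𝕜) • d w' f := by
      rw [h.euler_d, hE]
      push_cast
      rw [map_smul]
      module
    obtain ⟨f₀, hf₀, hf⟩ := ih hE' (by rw [h.d_d, hw, map_zero])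
      fun k hk => by rw [h.d_d, hs k hk, map_zero]
    have hEf := fr.two_smul_eulerOp (X := X) (d := d) f
    rw [hE, hw, map_zero, Finset.sum_eq_zero fun k hk => by rw [hs k hk, map_zero], hf] at hEf
    have hq : (2 * (q + 1 : ℕ) : 𝕜) ≠ 0 :=
      mul_ne_zero two_ne_zero (Nat.cast_ne_zero.2 q.succ_ne_zero)
    refine ⟨(2 * (q + 1 : ℕ) : 𝕜)⁻¹ • f₀, by rw [map_smul, hf₀, smul_zero], ?_⟩
    refine smul_right_injective F hq ?_
    rw [map_smul, pow_succ', Module.End.mul_apply]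
    simp only [smul_inv_smul₀ hq]
    linear_combination (norm := module) hEf

end LinearForms

/-! ### Vector-valued polynomials -/

section Polynomials

variable {𝕜 ι V : Type*} [CommRing 𝕜] [Fintype ι] [AddCommGroup V] [Module 𝕜 V]

/-- Multiplication of `V`-valued polynomials by the linear form `∑ uᵢ Xᵢ`. -/
def mulForm (V : Type*) [AddCommGroup V] [Module 𝕜 V] :
    (ι → 𝕜) →ₗ[𝕜] Module.End 𝕜 (MvPolynomial ι 𝕜 ⊗[𝕜] V) :=
  LinearMap.rTensorHom V ∘ₗ LinearMap.mul 𝕜 _ ∘ₗ Fintype.linearCombination 𝕜 MvPolynomial.X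

/-- The directional derivative `∑ uᵢ ∂ᵢ` of `V`-valued polynomials. -/
def dirDeriv (V : Type*) [AddCommGroup V] [Module 𝕜 V] :
    (ι → 𝕜) →ₗ[𝕜] Module.End 𝕜 (MvPolynomial ι 𝕜 ⊗[𝕜] V) :=
  LinearMap.rTensorHom V ∘ₗ
    Fintype.linearCombination 𝕜 fun i => (MvPolynomial.pderiv i).toLinearMap

/-- The operators `g u` applied to the values of `V`-valued polynomials. -/
def onValues (g : (ι → 𝕜) →ₗ[𝕜] Module.End 𝕜 V) :
    (ι → 𝕜) →ₗ[𝕜] Module.End 𝕜 (MvPolynomial ι 𝕜 ⊗[𝕜] V) :=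
  LinearMap.lTensorHom (MvPolynomial ι 𝕜) ∘ₗ g

@[simp] theorem mulForm_tmul (u : ι → 𝕜) (p : MvPolynomial ι 𝕜) (v : V) :
    mulForm V u (p ⊗ₜ v) = (∑ i, u i • (MvPolynomial.X i * p)) ⊗ₜ v := by
  simp [mulForm, Fintype.linearCombination_apply]

@[simp] theorem dirDeriv_tmul (u : ι → 𝕜) (p : MvPolynomial ι 𝕜) (v : V) :
    dirDeriv V u (p ⊗ₜ v) = (∑ i, u i • MvPolynomial.pderiv i p) ⊗ₜ v := by
  simp [dirDeriv, Fintype.linearCombination_apply]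

omit [Fintype ι] in
@[simp] theorem onValues_tmul (g : (ι → 𝕜) →ₗ[𝕜] Module.End 𝕜 V) (u : ι → 𝕜)
    (p : MvPolynomial ι 𝕜) (v : V) : onValues g u (p ⊗ₜ v) = p ⊗ₜ g u v := rfl

omit [Fintype ι] in
theorem pderiv_pderiv_comm (i j : ι) (p : MvPolynomial ι 𝕜) :
    MvPolynomial.pderiv i (MvPolynomial.pderiv j p) =
      MvPolynomial.pderiv j (MvPolynomial.pderiv i p) := by
  classical
  ext s
  rw [MvPolynomial.coeff_pderiv, MvPolynomial.coeff_pderiv, MvPolynomial.coeff_pderiv,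
    MvPolynomial.coeff_pderiv, add_right_comm s]
  by_cases hij : i = j
  · rw [hij]
  · simp [hij, Ne.symm hij, mul_right_comm]

theorem dirDeriv_mulForm (u v : ι → 𝕜) (f : MvPolynomial ι 𝕜 ⊗[𝕜] V) :
    dirDeriv V u (mulForm V v f) = mulForm V v (dirDeriv V u f) + (u ⬝ᵥ v) • f := by
  classical
  induction f with
  | zero => simp
  | add f₁ f₂ h₁ h₂ => simp only [map_add, h₁, h₂, smul_add]; abel
  | tmul p y =>
    simp only [mulForm_tmul, dirDeriv_tmul, TensorProduct.smul_tmul', ← TensorProduct.add_tmul]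
    congr 1
    simp only [map_sum, Derivation.map_smul, Derivation.leibniz, MvPolynomial.pderiv_X,
      Pi.single_apply, smul_eq_mul, smul_add, mul_ite, mul_one, mul_zero, Finset.sum_add_distrib,
      Finset.smul_sum, Finset.mul_sum, smul_ite, smul_zero, Finset.sum_ite_eq', Finset.mem_univ,
      if_true, dotProduct, Finset.sum_smul, mul_smul, mul_smul_comm]
    rw [Finset.sum_comm]
    simp only [smul_comm (v _) (u _)]

theorem IsCliffordMap.weylClifford {g : (ι → 𝕜) →ₗ[𝕜] Module.End 𝕜 V} (hg : IsCliffordMap g) :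
    WeylClifford (mulForm V) (dirDeriv V) (onValues g) where
  X_X u v f := by
    induction f with
    | zero => simp
    | add f₁ f₂ h₁ h₂ => simp only [map_add, h₁, h₂]
    | tmul p y =>
      simp only [mulForm_tmul, Finset.smul_sum, Finset.mul_sum, mul_smul_comm]
      rw [Finset.sum_comm]
      simp only [smul_comm (v _) (u _), mul_left_comm]
  d_d u v f := by
    induction f with
    | zero => simp
    | add f₁ f₂ h₁ h₂ => simp only [map_add, h₁, h₂]
    | tmul p y =>
      simp only [dirDeriv_tmul, map_sum, Derivation.map_smul, Finset.smul_sum]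
      rw [Finset.sum_comm]
      simp only [smul_comm (v _) (u _), pderiv_pderiv_comm]
  d_X := dirDeriv_mulForm
  G_X u v f := by
    induction f with
    | zero => simp
    | add f₁ f₂ h₁ h₂ => simp only [map_add, h₁, h₂]
    | tmul p y => simp
  G_d u v f := by
    induction f with
    | zero => simp
    | add f₁ f₂ h₁ h₂ => simp only [map_add, h₁, h₂]
    | tmul p y => simp
  isCliffordMap u f := by
    induction f with
    | zero => simp
    | add f₁ f₂ h₁ h₂ => simp only [map_add, h₁, h₂, smul_add]
    | tmul p y => rw [onValues_tmul, onValues_tmul, hg u y, TensorProduct.tmul_smul]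

theorem eq_top_of_mulForm_mem {S : Submodule 𝕜 (MvPolynomial ι 𝕜 ⊗[𝕜] V)}
    (h1 : ∀ v : V, 1 ⊗ₜ[𝕜] v ∈ S) (hX : ∀ u, ∀ f ∈ S, mulForm V u f ∈ S) : S = ⊤ := by
  classical
  refine Submodule.eq_top_iff'.2 fun f => ?_
  induction f with
  | zero => exact S.zero_mem
  | add f₁ f₂ h₁ h₂ => exact S.add_mem h₁ h₂
  | tmul p v =>
    induction p using MvPolynomial.induction_on with
    | C a =>
      rw [← mul_one (MvPolynomial.C a), ← MvPolynomial.smul_eq_C_mul, ← TensorProduct.smul_tmul']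
      exact S.smul_mem a (h1 v)
    | add p q hp hq => rw [TensorProduct.add_tmul]; exact S.add_mem hp hq
    | mul_X p i hp => simpa [Pi.single_apply, mul_comm] using hX (Pi.single i 1) _ hp

end Polynomials

section PolynomialEigenvalues

variable {𝕜 ι V : Type*} [Field 𝕜] [Fintype ι] [AddCommGroup V] [Module 𝕜 V]

theorem mulForm_injective {w : ι → 𝕜} (hw : w ≠ 0) :
    Function.Injective (mulForm V w : Module.End 𝕜 (MvPolynomial ι 𝕜 ⊗[𝕜] V)) := by
  classical
  have hform : Fintype.linearCombination 𝕜 MvPolynomial.X w ≠ (0 : MvPolynomial ι 𝕜) := by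
    refine fun h0 => hw (funext fun i => ?_)
    have := congrArg (MvPolynomial.coeff (Finsupp.single i 1)) h0
    simpa [Fintype.linearCombination_apply, MvPolynomial.coeff_sum, MvPolynomial.coeff_X,
      Finsupp.single_left_inj] using this
  exact Module.Flat.rTensor_preserves_injective_linearMap _
    (mul_right_injective₀ hform)

theorem mulForm_pow_injective {w : ι → 𝕜} (hw : w ≠ 0) (q : ℕ) :
    Function.Injective (mulForm V w ^ q : Module.End 𝕜 (MvPolynomial ι 𝕜 ⊗[𝕜] V)) := by
  rw [Module.End.coe_pow]
  exact (mulForm_injective hw).iterate q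

variable [DecidableEq ι] {g : (ι → 𝕜) →ₗ[𝕜] Module.End 𝕜 V} (hg : IsCliffordMap g)
include hg

theorem IsCliffordMap.iSup_eigenspace_eulerOp :
    ⨆ k : ℕ, (eulerOp (mulForm (ι := ι) V) (dirDeriv V)).eigenspace (k : 𝕜) = ⊤ := by
  refine eq_top_of_mulForm_mem (fun v => Submodule.mem_iSup_of_mem 0 ?_) fun i f hf =>
    mem_iSup_eigenspace_of_shift 1 (fun f => ?_) hf
  · simp [eulerOp_apply]
  · rw [hg.weylClifford.euler_X, Nat.cast_one, one_smul]

theorem IsCliffordMap.iSup_eigenspace_depthOp [NeZero (2 : 𝕜)] {w w' : ι → 𝕜} {s : Finset ι}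
    (fr : WittFrame w w' s) :
    ⨆ k : ℕ, (depthOp (mulForm V) (dirDeriv V) w w' s).eigenspace (k : 𝕜) = ⊤ := by
  refine eq_top_of_mulForm_mem (fun v => Submodule.mem_iSup_of_mem 0 ?_) fun u f hf =>
    hg.weylClifford.X_mem_iSup_eigenspace_depthOp fr u hf
  simp [depthOp_apply]

theorem IsCliffordMap.not_hasEigenvalue_eulerOp [CharZero 𝕜] :
    ¬ (eulerOp (mulForm (ι := ι) V) (dirDeriv V)).HasEigenvalue (-1 : 𝕜) :=
  not_hasEigenvalue_of_iSup_eigenspace_eq_top hg.iSup_eigenspace_eulerOp fun k h0 =>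
    k.succ_ne_zero (by exact_mod_cast add_eq_zero_iff_eq_neg.2 h0)

theorem IsCliffordMap.not_hasEigenvalue_depthOp [CharZero 𝕜] {w w' : ι → 𝕜} {s : Finset ι}
    (fr : WittFrame w w' s) {k : ℕ} (hk : k ≠ 0) :
    ¬ (depthOp (mulForm V) (dirDeriv V) w w' s).HasEigenvalue (-(k : 𝕜)) :=
  not_hasEigenvalue_of_iSup_eigenspace_eq_top (hg.iSup_eigenspace_depthOp fr) fun l h0 =>
    hk (by have : l + k = 0 := by exact_mod_cast add_eq_zero_iff_eq_neg.2 h0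
           omega)

end PolynomialEigenvalues

section Degree

variable {𝕜 ι : Type*}

theorem coeff_X_mul_pderiv [CommRing 𝕜] (i : ι) (p : MvPolynomial ι 𝕜) (s : ι →₀ ℕ) :
    (MvPolynomial.X i * MvPolynomial.pderiv i p).coeff s = s i * p.coeff s := by
  induction p using MvPolynomial.induction_on' with
  | monomial t c =>
    classical
    rw [MvPolynomial.X_mul_pderiv_monomial, MvPolynomial.coeff_smul, MvPolynomial.coeff_monomial]
    split_ifs with h
    · rw [h, nsmul_eq_mul]
    · simp
  | add p q hp hq => rw [map_add, mul_add, MvPolynomial.coeff_add, hp, hq, MvPolynomial.coeff_add,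
      mul_add]

theorem isHomogeneous_iff_sum_X_mul_pderiv [Fintype ι] [Field 𝕜] [CharZero 𝕜]
    {p : MvPolynomial ι 𝕜} {q : ℕ} :
    p.IsHomogeneous q ↔ ∑ i, MvPolynomial.X i * MvPolynomial.pderiv i p = (q : 𝕜) • p := by
  refine ⟨fun h => by rw [h.sum_X_mul_pderiv, Nat.cast_smul_eq_nsmul], fun h s hs => ?_⟩
  have hcoeff := congrArg (MvPolynomial.coeff s) h
  rw [MvPolynomial.coeff_sum, Finset.sum_congr rfl fun i _ => coeff_X_mul_pderiv i p s,
    ← Finset.sum_mul, MvPolynomial.coeff_smul, smul_eq_mul] at hcoeff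
  have hsum := mul_right_cancel₀ hs hcoeff
  rw [Finsupp.weight_apply, Finsupp.sum_fintype _ _ (by simp)]
  simp only [Pi.one_apply, smul_eq_mul, mul_one]
  exact_mod_cast hsum

end Degree

section DegreeSpaces

variable {𝕜 ι V : Type*} [Field 𝕜] [Fintype ι] [DecidableEq ι] [AddCommGroup V] [Module 𝕜 V]

/-- The Euler operator `∑ Xᵢ ∂ᵢ` on scalar polynomials, whose eigenspaces are the homogeneous
components. -/
def polyEuler (𝕜 ι : Type*) [Field 𝕜] [Fintype ι] : Module.End 𝕜 (MvPolynomial ι 𝕜) :=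
  ∑ i, LinearMap.mulLeft 𝕜 (MvPolynomial.X i) ∘ₗ (MvPolynomial.pderiv i).toLinearMap

omit [DecidableEq ι] in
theorem homogeneousSubmodule_eq_ker [CharZero 𝕜] (q : ℕ) :
    MvPolynomial.homogeneousSubmodule ι 𝕜 q =
      LinearMap.ker (polyEuler 𝕜 ι - algebraMap 𝕜 _ (q : 𝕜)) := by
  ext p
  rw [MvPolynomial.mem_homogeneousSubmodule, isHomogeneous_iff_sum_X_mul_pderiv, LinearMap.mem_ker,
    LinearMap.sub_apply, sub_eq_zero, Module.algebraMap_end_apply]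
  simp [polyEuler]

theorem eulerOp_eq_rTensor :
    eulerOp (mulForm V) (dirDeriv V) = (polyEuler 𝕜 ι).rTensor V := by
  refine TensorProduct.ext' fun p v => ?_
  simp [eulerOp_apply, polyEuler, TensorProduct.sum_tmul, Pi.single_apply]

theorem lapOp_eq_rTensor (n : ℕ) {V : Type*} [AddCommGroup V] [Module ℂ V] :
    lapOp (dirDeriv V) = (laplacian n).rTensor V := by
  refine TensorProduct.ext' fun p v => ?_
  simp [lapOp_apply, laplacian, TensorProduct.sum_tmul, Pi.single_apply]

omit [Fintype ι] [DecidableEq ι] in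
theorem range_rTensor_subtype_ker_inf_ker {P Q R : Type*} [AddCommGroup P] [Module 𝕜 P]
    [AddCommGroup Q] [Module 𝕜 Q] [AddCommGroup R] [Module 𝕜 R] (S : P →ₗ[𝕜] Q)
    (T : P →ₗ[𝕜] R) : LinearMap.range ((LinearMap.ker S ⊓ LinearMap.ker T).subtype.rTensor V) =
      LinearMap.ker (S.rTensor V) ⊓ LinearMap.ker (T.rTensor V) := by
  have hprod : (S.rTensor V).prod (T.rTensor V) =
      (TensorProduct.prodLeft 𝕜 𝕜 Q R V).toLinearMap ∘ₗ (S.prod T).rTensor V :=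
    TensorProduct.ext' fun p v => rfl
  rw [← LinearMap.ker_prod, ← LinearMap.ker_prod, hprod, LinearEquiv.ker_comp]
  exact (LinearMap.exact_iff.1
    (Module.Flat.rTensor_exact V (S.prod T).exact_subtype_ker_map)).symm

theorem ker_rTensor_polyEuler_sub (q : 𝕜) :
    LinearMap.ker ((polyEuler 𝕜 ι - algebraMap 𝕜 _ q).rTensor V) =
      (eulerOp (mulForm (ι := ι) V) (dirDeriv V)).eigenspace q := by
  ext f
  rw [LinearMap.mem_ker, Module.End.mem_eigenspace_iff, eulerOp_eq_rTensor, LinearMap.rTensor_sub,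
    LinearMap.sub_apply, sub_eq_zero, Algebra.algebraMap_eq_smul_one, LinearMap.rTensor_smul,
    Module.End.one_eq_id, LinearMap.rTensor_id]
  rfl

theorem mem_harmonicTensor {n q : ℕ} {V : Type*} [AddCommGroup V] [Module ℂ V]
    {f : MvPolynomial (Fin n) ℂ ⊗[ℂ] V} : f ∈ harmonicTensor n q V ↔
      eulerOp (mulForm V) (dirDeriv V) f = (q : ℂ) • f ∧ lapOp (dirDeriv V) f = 0 := by
  rw [harmonicTensor, harmonic, homogeneousSubmodule_eq_ker, range_rTensor_subtype_ker_inf_ker,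
    ker_rTensor_polyEuler_sub, ← lapOp_eq_rTensor, Submodule.mem_inf,
    Module.End.mem_eigenspace_iff, LinearMap.mem_ker]

variable [CharZero 𝕜]

theorem eigenspace_eulerOp_eq_range (q : ℕ) :
    (eulerOp (mulForm (ι := ι) V) (dirDeriv V)).eigenspace (q : 𝕜) =
      LinearMap.range ((MvPolynomial.homogeneousSubmodule ι 𝕜 q).subtype.rTensor V) := by
  rw [homogeneousSubmodule_eq_ker, ← ker_rTensor_polyEuler_sub]
  exact LinearMap.exact_iff.1 (Module.Flat.rTensor_exact V (LinearMap.exact_subtype_ker_map _))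

instance finiteDimensional_eigenspace_eulerOp [FiniteDimensional 𝕜 V] (q : ℕ) :
    FiniteDimensional 𝕜 ((eulerOp (mulForm (ι := ι) V) (dirDeriv V)).eigenspace (q : 𝕜)) := by
  have : FiniteDimensional 𝕜 (MvPolynomial.homogeneousSubmodule ι 𝕜 q) :=
    Module.Finite.iff_fg.2 (MvPolynomial.homogeneousSubmodule_fg _ _ q)
  rw [eigenspace_eulerOp_eq_range]
  infer_instance

theorem exists_eq_one_tmul {f : MvPolynomial ι 𝕜 ⊗[𝕜] V}
    (hf : eulerOp (mulForm V) (dirDeriv V) f = 0) : ∃ v : V, f = 1 ⊗ₜ v := by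
  have hexact : Function.Exact (Algebra.linearMap 𝕜 (MvPolynomial ι 𝕜)) (polyEuler 𝕜 ι) := by
    intro p
    have hconst := isHomogeneous_iff_sum_X_mul_pderiv (p := p) (q := 0)
    rw [← MvPolynomial.totalDegree_zero_iff_isHomogeneous,
      MvPolynomial.totalDegree_eq_zero_iff_eq_C, Nat.cast_zero, zero_smul] at hconst
    have hE : polyEuler 𝕜 ι p = ∑ i, MvPolynomial.X i * MvPolynomial.pderiv i p := by
      simp [polyEuler]
    rw [hE, ← hconst]
    refine ⟨fun h => ⟨_, Eq.symm h⟩, ?_⟩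
    rintro ⟨c, rfl⟩
    simp
  rw [eulerOp_eq_rTensor, Module.Flat.rTensor_exact V hexact] at hf
  obtain ⟨z, rfl⟩ := hf
  obtain ⟨v, rfl⟩ := (TensorProduct.lid 𝕜 V).symm.surjective z
  exact ⟨v, by simp⟩

omit [CharZero 𝕜] [Fintype ι] [DecidableEq ι] in
theorem one_tmul_injective : Function.Injective fun v : V => (1 : MvPolynomial ι 𝕜) ⊗ₜ[𝕜] v :=
  Module.FaithfullyFlat.tensorProduct_mk_injective V

theorem IsCliffordMap.exists_eq_mulForm_pow {g : (ι → 𝕜) →ₗ[𝕜] Module.End 𝕜 V}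
    (hg : IsCliffordMap g) {w w' : ι → 𝕜} {s : Finset ι} (fr : WittFrame w w' s) {q : ℕ}
    {f : MvPolynomial ι 𝕜 ⊗[𝕜] V} (hE : eulerOp (mulForm V) (dirDeriv V) f = (q : 𝕜) • f)
    (hw : dirDeriv V w f = 0) (hs : ∀ k ∈ s, dirDeriv V (Pi.single k 1) f = 0) :
    ∃ v : V, f = (mulForm V w ^ q) (1 ⊗ₜ v) := by
  obtain ⟨f₀, hf₀, rfl⟩ := hg.weylClifford.exists_eq_X_pow fr hE hw hs
  obtain ⟨v, rfl⟩ := exists_eq_one_tmul hf₀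
  exact ⟨v, rfl⟩

end DegreeSpaces

/-! ### The Fischer pairing -/

section FischerPairing

variable {𝕜 ι : Type*} [CommRing 𝕜] [Fintype ι]

/-- The Fischer pairing of polynomials, `⟨p, r⟩ = (p(∂) r)(0)`. -/
def fischer (𝕜 ι : Type*) [CommRing 𝕜] [Fintype ι] :
    MvPolynomial ι 𝕜 →ₗ[𝕜] Module.Dual 𝕜 (MvPolynomial ι 𝕜) :=
  (MvPolynomial.basisMonomials ι 𝕜).constr 𝕜 fun s =>
    ((∏ i, (s i).factorial : ℕ) : 𝕜) • MvPolynomial.lcoeff 𝕜 s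

theorem fischer_monomial (s : ι →₀ ℕ) (c : 𝕜) (p : MvPolynomial ι 𝕜) :
    fischer 𝕜 ι (MvPolynomial.monomial s c) p =
      c * (((∏ i, (s i).factorial : ℕ) : 𝕜) * p.coeff s) := by
  have hbasis : fischer 𝕜 ι (MvPolynomial.monomial s 1) p =
      ((∏ i, (s i).factorial : ℕ) : 𝕜) * p.coeff s := by
    rw [← congrFun (MvPolynomial.coe_basisMonomials ι 𝕜) s, fischer,
      Module.Basis.constr_basis]
    simp
  rw [← mul_one c, ← smul_eq_mul, ← MvPolynomial.smul_monomial, map_smul, LinearMap.smul_apply,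
    hbasis, smul_eq_mul, smul_eq_mul, mul_one]

theorem prod_factorial_add_single (s : ι →₀ ℕ) (i : ι) :
    ∏ j, ((s + Finsupp.single i 1 : ι →₀ ℕ) j).factorial = (s i + 1) * ∏ j, (s j).factorial := by
  classical
  rw [← Finset.mul_prod_erase _ _ (Finset.mem_univ i),
    ← Finset.mul_prod_erase Finset.univ (fun j => (s j).factorial) (Finset.mem_univ i),
    Finset.prod_congr rfl (g := fun j => (s j).factorial) fun j hj => by
      rw [Finsupp.add_apply, Finsupp.single_eq_of_ne (Finset.ne_of_mem_erase hj), add_zero]]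
  simp [Nat.factorial_succ, mul_assoc]

theorem fischer_X_mul (i : ι) (p r : MvPolynomial ι 𝕜) :
    fischer 𝕜 ι (MvPolynomial.X i * p) r = fischer 𝕜 ι p (MvPolynomial.pderiv i r) := by
  induction p using MvPolynomial.induction_on' with
  | monomial s c =>
    rw [MvPolynomial.X, MvPolynomial.monomial_mul, one_mul, fischer_monomial, fischer_monomial,
      MvPolynomial.coeff_pderiv, add_comm, prod_factorial_add_single]
    push_cast
    ring
  | add p q hp hq => simp only [mul_add, map_add, LinearMap.add_apply, hp, hq]

theorem fischer_comm (p r : MvPolynomial ι 𝕜) : fischer 𝕜 ι p r = fischer 𝕜 ι r p := by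
  classical
  induction p using MvPolynomial.induction_on' with
  | monomial s c =>
    induction r using MvPolynomial.induction_on' with
    | monomial t e =>
      rw [fischer_monomial, fischer_monomial, MvPolynomial.coeff_monomial,
        MvPolynomial.coeff_monomial]
      by_cases hst : s = t
      · rw [hst, if_pos rfl, if_pos rfl]; ring
      · rw [if_neg hst, if_neg (Ne.symm hst)]; ring
    | add p q hp hq => simp only [map_add, LinearMap.add_apply, hp, hq]
  | add p q hp hq => simp only [map_add, LinearMap.add_apply, hp, hq]

theorem fischer_pderiv (i : ι) (p r : MvPolynomial ι 𝕜) :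
    fischer 𝕜 ι (MvPolynomial.pderiv i p) r = fischer 𝕜 ι p (MvPolynomial.X i * r) := by
  rw [fischer_comm, ← fischer_X_mul, fischer_comm]

variable {V : Type*} [AddCommGroup V] [Module 𝕜 V]

/-- The Fischer pairing of polynomials with values in the dual of `V` and in `V`. -/
def pairing (𝕜 ι V : Type*) [CommRing 𝕜] [Fintype ι] [AddCommGroup V] [Module 𝕜 V] :
    MvPolynomial ι 𝕜 ⊗[𝕜] Module.Dual 𝕜 V →ₗ[𝕜] Module.Dual 𝕜 (MvPolynomial ι 𝕜 ⊗[𝕜] V) :=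
  TensorProduct.dualDistrib 𝕜 _ _ ∘ₗ (fischer 𝕜 ι).rTensor (Module.Dual 𝕜 V)

@[simp] theorem pairing_tmul (p r : MvPolynomial ι 𝕜) (φ : Module.Dual 𝕜 V) (v : V) :
    pairing 𝕜 ι V (p ⊗ₜ φ) (r ⊗ₜ v) = fischer 𝕜 ι p r * φ v := rfl

theorem pairing_adjoint {A : Module.End 𝕜 (MvPolynomial ι 𝕜 ⊗[𝕜] Module.Dual 𝕜 V)}
    {B : Module.End 𝕜 (MvPolynomial ι 𝕜 ⊗[𝕜] V)}
    (h : ∀ p φ r v, pairing 𝕜 ι V (A (p ⊗ₜ φ)) (r ⊗ₜ v) = pairing 𝕜 ι V (p ⊗ₜ φ) (B (r ⊗ₜ v)))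
    (ψ : MvPolynomial ι 𝕜 ⊗[𝕜] Module.Dual 𝕜 V) (f : MvPolynomial ι 𝕜 ⊗[𝕜] V) :
    pairing 𝕜 ι V (A ψ) f = pairing 𝕜 ι V ψ (B f) := by
  induction ψ with
  | zero => simp
  | add ψ₁ ψ₂ h₁ h₂ => simp only [map_add, LinearMap.add_apply, h₁, h₂]
  | tmul p φ =>
    induction f with
    | zero => simp
    | add f₁ f₂ h₁ h₂ => simp only [map_add, h₁, h₂]
    | tmul r v => exact h p φ r v

variable (ψ : MvPolynomial ι 𝕜 ⊗[𝕜] Module.Dual 𝕜 V) (f : MvPolynomial ι 𝕜 ⊗[𝕜] V)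
  (g : (ι → 𝕜) →ₗ[𝕜] Module.End 𝕜 V)

theorem pairing_mulForm (u : ι → 𝕜) :
    pairing 𝕜 ι V (mulForm _ u ψ) f = pairing 𝕜 ι V ψ (dirDeriv _ u f) :=
  pairing_adjoint (fun p φ r v => by simp [fischer_X_mul]) ψ f

theorem pairing_dirDeriv (u : ι → 𝕜) :
    pairing 𝕜 ι V (dirDeriv _ u ψ) f = pairing 𝕜 ι V ψ (mulForm _ u f) :=
  pairing_adjoint (fun p φ r v => by simp [fischer_pderiv]) ψ f

theorem pairing_onValues (u : ι → 𝕜) :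
    pairing 𝕜 ι V (onValues (Module.Dual.transpose ∘ₗ g) u ψ) f =
      pairing 𝕜 ι V ψ (onValues g u f) :=
  pairing_adjoint (fun _ _ _ _ => by
    simp only [onValues_tmul, pairing_tmul, LinearMap.comp_apply, Module.Dual.transpose_apply]) ψ f

omit [Fintype ι] in
theorem IsCliffordMap.transpose {g : (ι → 𝕜) →ₗ[𝕜] Module.End 𝕜 V} [Fintype ι]
    (hg : IsCliffordMap g) : IsCliffordMap (Module.Dual.transpose ∘ₗ g) := fun u φ =>
  LinearMap.ext fun v => by simp [Module.Dual.transpose_apply, hg u v]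

theorem pairing_rotOp (u v : ι → 𝕜) :
    pairing 𝕜 ι V (rotOp (mulForm _) (dirDeriv _) (onValues (Module.Dual.transpose ∘ₗ g)) u v ψ)
      f = -pairing 𝕜 ι V ψ (rotOp (mulForm _) (dirDeriv _) (onValues g) u v f) := by
  simp only [rotOp_apply, map_add, map_sub, map_smul, LinearMap.add_apply, LinearMap.sub_apply,
    LinearMap.smul_apply, pairing_mulForm, pairing_dirDeriv, pairing_onValues]
  module

theorem pairing_vecOp [DecidableEq ι] :
    pairing 𝕜 ι V (vecOp (mulForm _) (onValues (Module.Dual.transpose ∘ₗ g)) ψ) f =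
      pairing 𝕜 ι V ψ (diracOp (dirDeriv _) (onValues g) f) := by
  simp only [vecOp_apply, diracOp_apply, map_sum, LinearMap.sum_apply, pairing_mulForm,
    pairing_onValues]

theorem pairing_mulForm_pow (u : ι → 𝕜) (q : ℕ) :
    pairing 𝕜 ι V ((mulForm _ u ^ q) ψ) f = pairing 𝕜 ι V ψ ((dirDeriv _ u ^ q) f) := by
  induction q generalizing f with
  | zero => rfl
  | succ q ih =>
    rw [pow_succ', Module.End.mul_apply, pow_succ, Module.End.mul_apply, ← ih, pairing_mulForm]

theorem IsCliffordMap.pairing_mulForm_pow_mulForm_pow {g : (ι → 𝕜) →ₗ[𝕜] Module.End 𝕜 V}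
    (hg : IsCliffordMap g) (u x : ι → 𝕜) (q : ℕ) (φ : Module.Dual 𝕜 V) (v : V) :
    pairing 𝕜 ι V ((mulForm _ u ^ q) (1 ⊗ₜ φ)) ((mulForm _ x ^ q) (1 ⊗ₜ v)) =
      q.factorial * (u ⬝ᵥ x) ^ q * φ v := by
  rw [pairing_mulForm_pow, hg.weylClifford.d_pow_X_pow (by simp), map_smul, pairing_tmul,
    ← MvPolynomial.C_1, MvPolynomial.C_apply, fischer_monomial]
  simp

end FischerPairing

section Representer

variable {𝕜 ι V : Type*} [Fintype ι] [DecidableEq ι]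

theorem sum_coeff_smul_monomial_of_isHomogeneous [CommSemiring 𝕜] {p : MvPolynomial ι 𝕜} {q : ℕ}
    (hp : p.IsHomogeneous q) :
    ∑ s ∈ Finset.finsuppAntidiag Finset.univ q, p.coeff s • MvPolynomial.monomial s (1 : 𝕜) =
      p := by
  conv_rhs => rw [p.as_sum]
  simp only [MvPolynomial.smul_monomial, smul_eq_mul, mul_one]
  refine (Finset.sum_subset (fun s hs => ?_) fun s _ hs => ?_).symm
  · have hdeg := hp (MvPolynomial.mem_support_iff.1 hs)
    rw [Finsupp.weight_apply, Finsupp.sum_fintype _ _ (by simp)] at hdeg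
    rw [Finset.mem_finsuppAntidiag]
    exact ⟨by simpa using hdeg, Finset.subset_univ _⟩
  · rw [MvPolynomial.notMem_support_iff.1 hs, map_zero]

variable [Field 𝕜] [CharZero 𝕜] [AddCommGroup V] [Module 𝕜 V]

/-- The polynomial `∑ X^s / s! ⊗ ℓ(X^s ⊗ ·)` of degree `q`, whose Fischer pairing with the
polynomials of degree `q` is the functional `ℓ`. -/
def representer (ℓ : Module.Dual 𝕜 (MvPolynomial ι 𝕜 ⊗[𝕜] V)) (q : ℕ) :
    MvPolynomial ι 𝕜 ⊗[𝕜] Module.Dual 𝕜 V :=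
  ∑ s ∈ Finset.finsuppAntidiag Finset.univ q,
    MvPolynomial.monomial s ((∏ i, (s i).factorial : ℕ) : 𝕜)⁻¹ ⊗ₜ
      (ℓ ∘ₗ TensorProduct.mk 𝕜 _ V (MvPolynomial.monomial s 1))

variable (ℓ : Module.Dual 𝕜 (MvPolynomial ι 𝕜 ⊗[𝕜] V)) (q : ℕ)

theorem representer_mem_eigenspace :
    representer ℓ q ∈ (eulerOp (mulForm _) (dirDeriv _)).eigenspace (q : 𝕜) := by
  rw [eigenspace_eulerOp_eq_range]
  refine Submodule.sum_mem _ fun s hs => ⟨⟨_, ?_⟩ ⊗ₜ _, rfl⟩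
  refine MvPolynomial.isHomogeneous_monomial _ ?_
  rw [Finset.mem_finsuppAntidiag] at hs
  rw [Finsupp.degree_eq_sum, hs.1]

theorem pairing_representer {f : MvPolynomial ι 𝕜 ⊗[𝕜] V}
    (hf : f ∈ (eulerOp (mulForm V) (dirDeriv V)).eigenspace (q : 𝕜)) :
    pairing 𝕜 ι V (representer ℓ q) f = ℓ f := by
  rw [eigenspace_eulerOp_eq_range] at hf
  obtain ⟨u, rfl⟩ := hf
  induction u with
  | zero => simp
  | add u₁ u₂ h₁ h₂ => simp only [map_add, h₁, h₂]
  | tmul p v =>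
    obtain ⟨p, hp⟩ := p
    have hfac (s : ι →₀ ℕ) : ((∏ i, (s i).factorial : ℕ) : 𝕜) ≠ 0 :=
      Nat.cast_ne_zero.2 (Finset.prod_ne_zero_iff.2 fun i _ => Nat.factorial_ne_zero _)
    change _ = ℓ (p ⊗ₜ v)
    rw [LinearMap.rTensor_tmul, Submodule.subtype_apply, representer, map_sum,
      LinearMap.sum_apply]
    conv_rhs =>
      rw [← sum_coeff_smul_monomial_of_isHomogeneous hp, TensorProduct.sum_tmul, map_sum]
    refine Finset.sum_congr rfl fun s _ => ?_
    rw [pairing_tmul, fischer_monomial, inv_mul_cancel_left₀ (hfac s), ← TensorProduct.smul_tmul',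
      map_smul]
    rfl

end Representer

/-! ### Irreducible Clifford modules -/

section Spinors

variable {𝕜 ι V : Type*} [Fintype ι] [DecidableEq ι]

theorem exists_ne_zero_forall_apply_eq_zero_of_anticomm {κ : Type*} [CommRing 𝕜] [AddCommGroup V]
    [Module 𝕜 V] [Nontrivial V] {T : κ → Module.End 𝕜 V}
    (hT : ∀ i j v, T i (T j v) = -T j (T i v)) (hT₂ : ∀ i v, T i (T i v) = 0) (s : Finset κ) :
    ∃ v : V, v ≠ 0 ∧ ∀ i ∈ s, T i v = 0 := by
  classical
  induction s using Finset.induction_on with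
  | empty => exact (exists_ne (0 : V)).imp fun v hv => ⟨hv, by simp⟩
  | insert j s _ ih =>
    obtain ⟨v, hv, hs⟩ := ih
    by_cases hj : T j v = 0
    · exact ⟨v, hv, by simpa [hj] using hs⟩
    · refine ⟨T j v, hj, fun i hi => ?_⟩
      rcases Finset.mem_insert.1 hi with rfl | hi
      · exact hT₂ i v
      · rw [hT, hs i hi, map_zero, neg_zero]

variable [Field 𝕜] [AddCommGroup V] [Module 𝕜 V]

/-- The product of the Clifford operators of standard basis vectors, in the order of a list. -/
def cliffordProd (g : (ι → 𝕜) →ₗ[𝕜] Module.End 𝕜 V) (l : List ι) : Module.End 𝕜 V :=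
  (l.map fun i => g (Pi.single i 1)).prod

/-- No subspace other than `⊥` and `⊤` is invariant under all the operators `g u`. -/
def IsIrreducibleMap (g : (ι → 𝕜) →ₗ[𝕜] Module.End 𝕜 V) : Prop :=
  ∀ W : Submodule 𝕜 V, (∀ u, ∀ v ∈ W, g u v ∈ W) → W = ⊥ ∨ W = ⊤

variable {g : (ι → 𝕜) →ₗ[𝕜] Module.End 𝕜 V}

omit [Fintype ι] in
theorem cliffordProd_cons (k : ι) (l : List ι) (v : V) :
    cliffordProd g (k :: l) v = g (Pi.single k 1) (cliffordProd g l v) := by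
  simp [cliffordProd]

omit [Fintype ι] in
theorem cliffordProd_mem {W : Submodule 𝕜 V} (hW : ∀ u v, ∀ w ∈ W, g u (g v w) ∈ W) {w : V}
    (hw : w ∈ W) : ∀ l : List ι, Even l.length → cliffordProd g l w ∈ W
  | [], _ => by simpa [cliffordProd] using hw
  | [_], hl => by simp at hl
  | k :: l :: t, ht => by
    rw [cliffordProd_cons, cliffordProd_cons]
    exact hW _ _ _ (cliffordProd_mem hW hw t (by simpa [parity_simps] using ht))

omit [Fintype ι] in
theorem mem_of_single_mem [Finite ι] {W : Submodule 𝕜 V} {v : V} (h : ∀ k, g (Pi.single k 1) v ∈ W)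
    (u : ι → 𝕜) : g u v ∈ W := by
  cases nonempty_fintype ι
  rw [← sum_smul_apply_single g]
  exact W.sum_mem fun k _ => W.smul_mem _ (h k)

namespace IsCliffordMap

variable (hg : IsCliffordMap g)
include hg

theorem apply_single_apply_single (k : ι) (v : V) :
    g (Pi.single k 1) (g (Pi.single k 1) v) = -v := by
  rw [hg, single_one_dotProduct, Pi.single_eq_same, neg_one_smul]

theorem anticomm_single {k l : ι} (hkl : k ≠ l) (v : V) :
    g (Pi.single k 1) (g (Pi.single l 1) v) = -g (Pi.single l 1) (g (Pi.single k 1) v) :=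
  hg.anticomm (by rw [single_one_dotProduct, Pi.single_eq_of_ne hkl]) v

theorem isUnit_cliffordProd (l : List ι) : IsUnit (cliffordProd g l) := by
  refine List.prod_isUnit fun T hT => ?_
  obtain ⟨k, _, rfl⟩ := List.mem_map.1 hT
  refine isUnit_iff_exists.2 ⟨-g (Pi.single k 1), ?_, ?_⟩ <;>
    exact LinearMap.ext fun v => by simp [hg.apply_single_apply_single]

theorem cliffordProd_apply_of_notMem {k : ι} {l : List ι} (hk : k ∉ l) (v : V) :
    cliffordProd g l (g (Pi.single k 1) v) =
      (-1 : 𝕜) ^ l.length • g (Pi.single k 1) (cliffordProd g l v) := by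
  induction l with
  | nil => simp [cliffordProd]
  | cons i l ih =>
    rw [List.mem_cons, not_or] at hk
    rw [cliffordProd_cons, ih hk.2, cliffordProd_cons, map_smul, hg.anticomm_single (Ne.symm hk.1),
      List.length_cons, pow_succ, mul_neg_one, neg_smul, smul_neg]

theorem cliffordProd_apply_of_mem {k : ι} {l : List ι} (hl : l.Nodup) (hk : k ∈ l) (v : V) :
    cliffordProd g l (g (Pi.single k 1) v) =
      (-1 : 𝕜) ^ (l.length + 1) • g (Pi.single k 1) (cliffordProd g l v) := by
  induction l with
  | nil => simp at hk
  | cons i l ih =>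
    rw [List.nodup_cons] at hl
    rw [cliffordProd_cons, cliffordProd_cons, List.length_cons]
    obtain rfl | hki := eq_or_ne k i
    · rw [hg.cliffordProd_apply_of_notMem hl.1, map_smul, pow_succ, pow_succ]
      simp
    · rw [ih hl.2 ((List.mem_cons.1 hk).resolve_left hki), map_smul, hg.anticomm_single hki.symm,
        pow_succ _ (l.length + 1), mul_neg_one, neg_smul, smul_neg]

theorem exists_cliffordProd_apply_eq_smul [IsAlgClosed 𝕜] [FiniteDimensional 𝕜 V] [Nontrivial V]
    (hi : IsIrreducibleMap g) (hι : Odd (Fintype.card ι)) {l : List ι} (hl : l.Nodup)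
    (hmem : ∀ k, k ∈ l) : ∃ c : 𝕜, c ≠ 0 ∧ ∀ v, cliffordProd g l v = c • v := by
  have hlen : l.length = Fintype.card ι := by
    rw [← List.toFinset_card_of_nodup hl,
      Finset.eq_univ_iff_forall.2 fun k => List.mem_toFinset.2 (hmem k), Finset.card_univ]
  have hcomm (k : ι) (v : V) :
      cliffordProd g l (g (Pi.single k 1) v) = g (Pi.single k 1) (cliffordProd g l v) := by
    rw [hg.cliffordProd_apply_of_mem hl (hmem k), hlen, hι.add_one.neg_one_pow, one_smul]
  obtain ⟨c, hc⟩ := Module.End.exists_eigenvalue (cliffordProd g l)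
  have htop : (cliffordProd g l).eigenspace c = ⊤ := by
    refine (hi _ fun u v hv => mem_of_single_mem (fun k => ?_) u).resolve_left hc
    rw [Module.End.mem_eigenspace_iff] at hv ⊢
    rw [hcomm, hv, map_smul]
  have hsmul (v : V) : cliffordProd g l v = c • v :=
    Module.End.mem_eigenspace_iff.1 (htop ▸ Submodule.mem_top)
  refine ⟨c, ?_, hsmul⟩
  rintro rfl
  obtain ⟨v, hv⟩ := exists_ne (0 : V)
  have hinj := ((Module.End.isUnit_iff _).1 (hg.isUnit_cliffordProd l)).injective
  exact hv (hinj (by rw [hsmul, zero_smul, map_zero]))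

omit [DecidableEq ι] in
/-- As the volume element acts by a scalar, every Clifford operator is a multiple of a product of
an even number of others. -/
theorem eq_bot_or_eq_top_of_even [IsAlgClosed 𝕜] [FiniteDimensional 𝕜 V] [Nontrivial V]
    (hi : IsIrreducibleMap g) (hι : Odd (Fintype.card ι)) {W : Submodule 𝕜 V}
    (hW : ∀ u v, ∀ w ∈ W, g u (g v w) ∈ W) : W = ⊥ ∨ W = ⊤ := by
  classical
  refine hi W fun u w hw => mem_of_single_mem (fun k => ?_) u
  set l := (Finset.univ.erase k).toList with hl
  have hlen : Even l.length := by
    rw [hl, Finset.length_toList, Finset.card_erase_of_mem (Finset.mem_univ k), Finset.card_univ]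
    exact Nat.Odd.sub_odd hι odd_one
  obtain ⟨c, hc, hvol⟩ := hg.exists_cliffordProd_apply_eq_smul hi hι (l := k :: l)
    (List.nodup_cons.2 ⟨by simp [hl], Finset.nodup_toList _⟩) (by simp [hl, em])
  have hk : -cliffordProd g l w = c • g (Pi.single k 1) w := by
    rw [← map_smul, ← hvol, cliffordProd_cons, hg.apply_single_apply_single]
  rw [← inv_smul_smul₀ hc (g (Pi.single k 1) w), ← hk]
  exact W.smul_mem _ (W.neg_mem (cliffordProd_mem hW hw l hlen))

variable {w w' : ι → 𝕜} {s : Finset ι}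

theorem apply_left_apply_right (fr : WittFrame w w' s) {v : V} (hv : g w v = 0) :
    g w (g w' v) = (-4 : 𝕜) • v := by
  rw [hg.apply_apply, hv, map_zero, fr.dot]
  module

variable [CharZero 𝕜]

theorem apply_mem_sup_map (fr : WittFrame w w' s) {A B : Submodule 𝕜 V}
    (hA : ∀ v ∈ A, g w v = 0) (hB : ∀ v ∈ B, g w v = 0)
    (hAB : ∀ k ∈ s, ∀ v ∈ A, g (Pi.single k 1) v ∈ B)
    (hBA : ∀ k ∈ s, ∀ v ∈ B, g (Pi.single k 1) v ∈ A) (u : ι → 𝕜) {v : V}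
    (hv : v ∈ A ⊔ B.map (g w')) : g u v ∈ B ⊔ A.map (g w') := by
  obtain ⟨a, ha, _, ⟨b, hb, rfl⟩, rfl⟩ := Submodule.mem_sup.1 hv
  have hleft : g w (a + g w' b) ∈ B ⊔ A.map (g w') := by
    rw [map_add, hA a ha, zero_add, hg.apply_left_apply_right fr (hB b hb)]
    exact Submodule.mem_sup_left (B.smul_mem _ hb)
  have hright : g w' (a + g w' b) ∈ B ⊔ A.map (g w') := by
    rw [map_add, hg.apply_self_of_isotropic fr.dot_self_right, add_zero]
    exact Submodule.mem_sup_right (Submodule.mem_map_of_mem ha)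
  have hsingle (k : ι) (hk : k ∈ s) : g (Pi.single k 1) (a + g w' b) ∈ B ⊔ A.map (g w') := by
    rw [map_add, hg.anticomm (by rw [single_one_dotProduct, fr.right_apply k hk]), ← map_neg]
    exact Submodule.add_mem_sup (hAB k hk a ha)
      (Submodule.mem_map_of_mem (A.neg_mem (hBA k hk b hb)))
  have htwo := congrArg (fun x => g x (a + g w' b)) (fr.two_smul_eq u)
  simp only [map_add g, map_smul g, map_sum g, LinearMap.add_apply, LinearMap.smul_apply,
    LinearMap.sum_apply] at htwo
  rw [← inv_smul_smul₀ (two_ne_zero (α := 𝕜)) (g u _), htwo]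
  exact Submodule.smul_mem _ _ (Submodule.add_mem _ (Submodule.add_mem _
    (Submodule.smul_mem _ _ hleft) (Submodule.smul_mem _ _ hright)) (Submodule.smul_mem _ _
    (Submodule.sum_mem _ fun k hk => Submodule.smul_mem _ _ (hsingle k hk))))

/-- If `T` is such a subspace, its even and odd translates span a subspace invariant under the
even part of the Clifford algebra. -/
theorem mem_of_apply_left_eq_zero [IsAlgClosed 𝕜] [FiniteDimensional 𝕜 V] [Nontrivial V]
    (hi : IsIrreducibleMap g) (hι : Odd (Fintype.card ι)) (fr : WittFrame w w' s)
    {T : Submodule 𝕜 V} (hT₀ : T ≠ ⊥) (hT : ∀ t ∈ T, g w t = 0)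
    (hinv : ∀ k ∈ s, ∀ l ∈ s, ∀ t ∈ T, g (Pi.single k 1) (g (Pi.single l 1) t) ∈ T) {v : V}
    (hv : g w v = 0) : v ∈ T := by
  let S : Submodule 𝕜 V := ⨆ k ∈ s, T.map (g (Pi.single k 1))
  have hS : ∀ A : Submodule 𝕜 V, S ≤ A ↔ ∀ k ∈ s, ∀ t ∈ T, g (Pi.single k 1) t ∈ A := fun A =>
    iSup₂_le_iff.trans (forall₂_congr fun k _ => Submodule.map_le_iff_le_comap)
  have hSker : ∀ b ∈ S, g w b = 0 := (hS (LinearMap.ker (g w))).2 fun k hk t ht => by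
    rw [LinearMap.mem_ker, hg.anticomm (by rw [dotProduct_single_one, fr.left_apply k hk]),
      hT t ht, map_zero, neg_zero]
  have hTS : ∀ k ∈ s, ∀ t ∈ T, g (Pi.single k 1) t ∈ S := (hS S).1 le_rfl
  have hST : ∀ k ∈ s, ∀ b ∈ S, g (Pi.single k 1) b ∈ T := fun k hk =>
    (hS (T.comap (g (Pi.single k 1)))).2 fun l hl t ht => hinv k hk l hl t ht
  have htop : T ⊔ S.map (g w') = ⊤ :=
    (hg.eq_bot_or_eq_top_of_even hi hι fun u x y hy =>
      hg.apply_mem_sup_map fr hSker hT hST hTS u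
        (hg.apply_mem_sup_map fr hT hSker hTS hST x hy)).resolve_left
      fun h => hT₀ (le_bot_iff.1 (h ▸ le_sup_left))
  obtain ⟨t, ht, _, ⟨b, hb, rfl⟩, rfl⟩ :=
    Submodule.mem_sup.1 (htop ▸ Submodule.mem_top : v ∈ T ⊔ S.map (g w'))
  rw [map_add, hT t ht, zero_add, hg.apply_left_apply_right fr (hSker b hb)] at hv
  rwa [(smul_eq_zero.1 hv).resolve_left (by norm_num), map_zero, add_zero]

end IsCliffordMap

end Spinors

/-! ### Irreducibility of the spaces of monogenic polynomials -/

section MonogenicPolynomials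

local notation "rot[" g "]" => rotOp (mulForm _) (dirDeriv _) (onValues g)
local notation "𝓜[" g "]" => monogenic (mulForm _) (dirDeriv _) (onValues g)

variable {𝕜 ι V : Type*} [Field 𝕜] [Fintype ι] [DecidableEq ι] [AddCommGroup V] [Module 𝕜 V]
  {g : (ι → 𝕜) →ₗ[𝕜] Module.End 𝕜 V} {q : ℕ} {W : Submodule 𝕜 (MvPolynomial ι 𝕜 ⊗[𝕜] V)}

omit [DecidableEq ι] in
theorem rotOp_one_tmul (u v : ι → 𝕜) (y : V) :
    rot[g] u v ((1 : MvPolynomial ι 𝕜) ⊗ₜ[𝕜] y) = 1 ⊗ₜ (g u (g v y) - g v (g u y)) := by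
  simp [rotOp_apply, TensorProduct.tmul_sub]

/-- The monogenic polynomials of degree `q` with values in the dual of `V` that are orthogonal to
`W` for the Fischer pairing. -/
def monogenicAnnihilator (g : (ι → 𝕜) →ₗ[𝕜] Module.End 𝕜 V) (q : ℕ)
    (W : Submodule 𝕜 (MvPolynomial ι 𝕜 ⊗[𝕜] V)) :
    Submodule 𝕜 (MvPolynomial ι 𝕜 ⊗[𝕜] Module.Dual 𝕜 V) :=
  𝓜[Module.Dual.transpose ∘ₗ g] q ⊓ W.dualAnnihilator.comap (pairing 𝕜 ι V)

theorem mem_monogenicAnnihilator {ψ : MvPolynomial ι 𝕜 ⊗[𝕜] Module.Dual 𝕜 V} :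
    ψ ∈ monogenicAnnihilator g q W ↔
      ψ ∈ 𝓜[Module.Dual.transpose ∘ₗ g] q ∧ ∀ f ∈ W, pairing 𝕜 ι V ψ f = 0 := by
  rw [monogenicAnnihilator, Submodule.mem_inf, Submodule.mem_comap, Submodule.mem_dualAnnihilator]

namespace IsCliffordMap

variable (hg : IsCliffordMap g)
include hg

theorem rotOp_mem_monogenic (u v : ι → 𝕜) {f : MvPolynomial ι 𝕜 ⊗[𝕜] V} (hf : f ∈ 𝓜[g] q) :
    rot[g] u v f ∈ 𝓜[g] q := by
  rw [mem_monogenic] at hf ⊢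
  rw [hg.weylClifford.dirac_rot, hg.weylClifford.euler_rot, hf.1, hf.2, map_zero, map_smul]
  exact ⟨rfl, rfl⟩

theorem rotOp_mem_monogenicAnnihilator (hinv : ∀ u v, ∀ f ∈ W, rot[g] u v f ∈ W) (u v : ι → 𝕜)
    {ψ : MvPolynomial ι 𝕜 ⊗[𝕜] Module.Dual 𝕜 V} (hψ : ψ ∈ monogenicAnnihilator g q W) :
    rot[Module.Dual.transpose ∘ₗ g] u v ψ ∈ monogenicAnnihilator g q W := by
  rw [mem_monogenicAnnihilator] at hψ ⊢
  refine ⟨hg.transpose.rotOp_mem_monogenic u v hψ.1, fun f hf => ?_⟩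
  rw [pairing_rotOp, hψ.2 _ (hinv u v f hf), neg_zero]

variable [CharZero 𝕜]

theorem exists_mem_monogenic_pairing_eq [Nonempty ι]
    (ℓ : Module.Dual 𝕜 (MvPolynomial ι 𝕜 ⊗[𝕜] V)) (q : ℕ) :
    ∃ ψ ∈ 𝓜[Module.Dual.transpose ∘ₗ g] q, ∀ f ∈ 𝓜[g] q, pairing 𝕜 ι V ψ f = ℓ f := by
  obtain ⟨ψ, hψ, _, ⟨χ, rfl⟩, hsum⟩ := Submodule.mem_sup.1
    (hg.transpose.weylClifford.eigenspace_le_monogenic_sup hg.transpose.not_hasEigenvalue_eulerOp q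
      (representer_mem_eigenspace ℓ q))
  refine ⟨ψ, hψ, fun f hf => ?_⟩
  rw [← pairing_representer ℓ q hf.2, ← hsum, map_add, LinearMap.add_apply, pairing_vecOp,
    (mem_monogenic.1 hf).1, map_zero, add_zero]

theorem monogenicAnnihilator_ne_bot [Nonempty ι] {f₀ : MvPolynomial ι 𝕜 ⊗[𝕜] V}
    (hf₀ : f₀ ∈ 𝓜[g] q) (hW : W ≤ 𝓜[g] q) (hf₀W : f₀ ∉ W) : monogenicAnnihilator g q W ≠ ⊥ := by
  obtain ⟨ℓ, hℓ, hℓW⟩ := Submodule.exists_dual_map_eq_bot_of_notMem hf₀W inferInstance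
  obtain ⟨ψ, hψ, hpair⟩ := hg.exists_mem_monogenic_pairing_eq ℓ q
  refine (Submodule.ne_bot_iff _).2 ⟨ψ, mem_monogenicAnnihilator.2 ⟨hψ, fun f hf => ?_⟩, ?_⟩
  · rw [hpair f (hW hf)]
    exact LinearMap.le_ker_iff_map.2 hℓW hf
  · rintro rfl
    exact hℓ (by rw [← hpair f₀ hf₀, map_zero, LinearMap.zero_apply])

variable {w w' : ι → 𝕜} {s : Finset ι} (fr : WittFrame w w' s)
include fr

theorem exists_eq_mulForm_pow_of_rotOp_eq_zero (hs : s.Nonempty)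
    {f : MvPolynomial ι 𝕜 ⊗[𝕜] V} (hf : f ∈ 𝓜[g] q)
    (hrot : ∀ k ∈ s, rot[g] w (Pi.single k 1) f = 0) :
    ∃ y : V, g w y = 0 ∧ f = (mulForm V w ^ q) (1 ⊗ₜ y) := by
  have h := hg.weylClifford
  have hX := mulForm_injective (V := V) fr.left_ne_zero
  have hN := hg.not_hasEigenvalue_depthOp fr hs.card_ne_zero
  obtain ⟨hD, hE⟩ := mem_monogenic.1 hf
  obtain ⟨y, rfl⟩ := hg.exists_eq_mulForm_pow fr hE
    (h.d_left_eq_zero_of_rotOp_eq_zero fr hX hN hD hrot)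
    fun k hk => h.d_single_eq_zero_of_rotOp_eq_zero fr hX hN hD hrot hk
  have hG := h.G_left_eq_zero_of_rotOp_eq_zero fr hX hN hD hrot
  rw [h.G_pow_X, map_eq_zero_iff _ (mulForm_pow_injective fr.left_ne_zero q)] at hG
  exact ⟨y, one_tmul_injective (hG.trans (TensorProduct.tmul_zero _ _).symm), rfl⟩

theorem rotOp_mulForm_pow {y : V} (hy : g w y = 0) :
    rot[g] w' w ((mulForm V w ^ q) (1 ⊗ₜ y)) =
      (8 * (q + 1 / 2 : 𝕜)) • (mulForm V w ^ q) (1 ⊗ₜ y) := by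
  rw [hg.weylClifford.rotOp_pow_X fr.symm.rotVec_right, rotOp_one_tmul, hy, map_zero, zero_sub,
    hg.apply_left_apply_right fr hy, TensorProduct.tmul_neg, TensorProduct.tmul_smul, map_neg,
    map_smul]
  module

variable [IsAlgClosed 𝕜] [FiniteDimensional 𝕜 V] (hs : s.Nonempty)
include hs

theorem exists_mulForm_pow_mem (hW₀ : W ≠ ⊥) (hW : W ≤ 𝓜[g] q)
    (hinv : ∀ u v, ∀ f ∈ W, rot[g] u v f ∈ W) :
    ∃ y : V, y ≠ 0 ∧ g w y = 0 ∧ (mulForm V w ^ q) (1 ⊗ₜ y) ∈ W := by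
  have : FiniteDimensional 𝕜 W := Submodule.finiteDimensional_of_le (hW.trans inf_le_right)
  obtain ⟨f, hfW, hf₀, hf⟩ := exists_ne_zero_forall_apply_eq_zero hW₀ (L := rot[g] w w')
    (E := fun k : s => rot[g] w (Pi.single k.1 1)) (c := -8) (by norm_num) (hinv w w')
    (fun k => hinv w _) fun k f => by
      rw [hg.weylClifford.rotOp_rotOp, fr.rotVec_left, fr.rotVec_single k.2]
      simp only [rotOp_apply, map_smul, map_zero, LinearMap.smul_apply, LinearMap.zero_apply]
      module
  obtain ⟨y, hy, rfl⟩ := hg.exists_eq_mulForm_pow_of_rotOp_eq_zero fr hs (hW hfW)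
    fun k hk => hf ⟨k, hk⟩
  exact ⟨y, fun hy₀ => hf₀ (by rw [hy₀, TensorProduct.tmul_zero, map_zero]), hy, hfW⟩

variable [Nontrivial V] (hi : IsIrreducibleMap g) (hι : Odd (Fintype.card ι))
include hi hι

theorem mulForm_pow_mem (hW₀ : W ≠ ⊥) (hW : W ≤ 𝓜[g] q)
    (hinv : ∀ u v, ∀ f ∈ W, rot[g] u v f ∈ W) {y : V} (hy : g w y = 0) :
    (mulForm V w ^ q) (1 ⊗ₜ y) ∈ W := by
  obtain ⟨y₀, hy₀, hgy₀, hmem⟩ := hg.exists_mulForm_pow_mem fr hs hW₀ hW hinv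
  let T : Submodule 𝕜 V := LinearMap.ker (g w) ⊓
    W.comap ((mulForm V w ^ q) ∘ₗ TensorProduct.mk 𝕜 _ V 1)
  refine (hg.mem_of_apply_left_eq_zero hi hι fr (T := T)
    ((Submodule.ne_bot_iff _).2 ⟨y₀, ⟨hgy₀, hmem⟩, hy₀⟩) (fun t ht => ht.1) ?_ hy).2
  intro k hk l hl t ht
  have hcomm : g (Pi.single k 1) (g (Pi.single l 1) t) - g (Pi.single l 1) (g (Pi.single k 1) t) ∈
      T := by
    refine ⟨?_, ?_⟩
    · have hanti {j : ι} (hj : j ∈ s) (x : V) :=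
        hg.anticomm (u := w) (v := Pi.single j 1) (by rw [dotProduct_single_one,
          fr.left_apply j hj]) x
      change g w (_ - _) = 0
      rw [map_sub, hanti hk, hanti hl, hanti hl, hanti hk,
        LinearMap.mem_ker.1 ht.1]
      simp
    · have hrot := hinv (Pi.single k 1) (Pi.single l 1) _ ht.2
      rw [LinearMap.comp_apply, hg.weylClifford.rotOp_pow_X (c := 0)
        (by simp [rotVec, fr.left_apply k hk, fr.left_apply l hl]), mul_zero, zero_smul, add_zero,
        TensorProduct.mk_apply, rotOp_one_tmul] at hrot
      exact hrot
  have htwo : g (Pi.single k 1) (g (Pi.single l 1) t) = (2 : 𝕜)⁻¹ •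
      (g (Pi.single k 1) (g (Pi.single l 1) t) - g (Pi.single l 1) (g (Pi.single k 1) t)) -
        ((Pi.single k 1 : ι → 𝕜) ⬝ᵥ Pi.single l 1) • t := by
    rw [hg.apply_apply (Pi.single l 1), dotProduct_comm (Pi.single l 1)]
    module
  rw [htwo]
  exact T.sub_mem (T.smul_mem _ hcomm) (T.smul_mem _ ht)

/-- If `W` is a proper subspace, its annihilator contains some `w'^q φ` with `φ ∘ g w' = 0`. As `W`
contains `w^q y` for every `y` in the kernel of `g w`, the functional `φ` vanishes on this kernel,
which together with the range of `g w'` spans `V`. -/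
theorem eq_monogenic_of_rotOp_mem (hW₀ : W ≠ ⊥) (hW : W ≤ 𝓜[g] q)
    (hinv : ∀ u v, ∀ f ∈ W, rot[g] u v f ∈ W) : W = 𝓜[g] q := by
  have : Nonempty ι := ⟨hs.choose⟩
  by_contra hne
  obtain ⟨f₀, hf₀, hf₀W⟩ := SetLike.exists_of_lt (lt_of_le_of_ne hW hne)
  obtain ⟨φ, hφ₀, hφ, hφW⟩ := hg.transpose.exists_mulForm_pow_mem fr.symm hs
    (hg.monogenicAnnihilator_ne_bot hf₀ hW hf₀W) inf_le_left
    fun u v ψ => hg.rotOp_mem_monogenicAnnihilator hinv u v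
  have hker : ∀ y, g w y = 0 → φ y = 0 := fun y hy => by
    have hpair := (mem_monogenicAnnihilator.1 hφW).2 _
      (hg.mulForm_pow_mem fr hs hi hι hW₀ hW hinv hy)
    rw [hg.pairing_mulForm_pow_mulForm_pow, fr.symm.dot] at hpair
    exact (mul_eq_zero.1 hpair).resolve_left
      (mul_ne_zero (Nat.cast_ne_zero.2 q.factorial_ne_zero) (pow_ne_zero _ two_ne_zero))
  have hrange (y : V) : φ (g w' y) = 0 := LinearMap.congr_fun hφ y
  refine hφ₀ (LinearMap.ext fun y => ?_)
  have hsum := congrArg φ (hg.apply_apply w w' y)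
  rw [hker _ (hg.apply_self_of_isotropic fr.dot_self_left _), fr.dot, map_sub, map_neg, hrange,
    neg_zero, zero_sub, map_smul, zero_eq_neg, smul_eq_mul] at hsum
  exact (mul_eq_zero.1 hsum).resolve_left (by norm_num)

end IsCliffordMap

end MonogenicPolynomials

/-! ### Representations of the spin Lie algebra -/

section SpinRepresentations

variable {n : ℕ} {U : Type*} [AddCommGroup U] [Module ℂ U]

theorem spinLie_induction {p : spinLie n → Prop} (br : ∀ k l, p (br k l)) (zero : p 0)
    (add : ∀ A B, p A → p B → p (A + B)) (smul : ∀ (c : ℝ) A, p A → p (c • A)) (A : spinLie n) :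
    p A := by
  obtain ⟨A, hA⟩ := A
  change A ∈ Submodule.span ℝ _ at hA
  induction hA using Submodule.span_induction with
  | zero => exact zero
  | add a b ha hb h₁ h₂ => exact add ⟨a, ha⟩ ⟨b, hb⟩ h₁ h₂
  | smul c a ha h => exact smul c ⟨a, ha⟩ h
  | mem a ha =>
    obtain ⟨⟨k, l⟩, rfl⟩ := ha
    exact br k l

theorem br_swap (k l : Fin n) : br l k = -br k l :=
  Subtype.ext (lie_skew (e l : Cl n) (e k)).symm

theorem br_self (k : Fin n) : br k k = 0 :=
  Subtype.ext (lie_self (e k : Cl n))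

section

variable (ρ : SpinRep n U)

theorem SpinRep.smul_apply (c : ℝ) (A : spinLie n) (f : U) : ρ (c • A) f = (c : ℂ) • ρ A f := by
  rw [map_smul]
  rfl

theorem brC_add_left (u u' v : Fin n → ℂ) : brC ρ (u + u') v = brC ρ u v + brC ρ u' v := by
  simp only [brC, Pi.add_apply, add_mul, add_smul, Finset.sum_add_distrib]

theorem brC_smul_left (c : ℂ) (u v : Fin n → ℂ) : brC ρ (c • u) v = c • brC ρ u v := by
  simp only [brC, Pi.smul_apply, smul_eq_mul, mul_assoc, mul_smul, Finset.smul_sum]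

theorem brC_swap (u v : Fin n → ℂ) : brC ρ v u = -brC ρ u v := by
  simp only [brC, ← Finset.sum_neg_distrib]
  rw [Finset.sum_comm]
  refine Finset.sum_congr rfl fun k _ => Finset.sum_congr rfl fun l _ => ?_
  rw [br_swap k l, map_neg, smul_neg, mul_comm]

theorem brC_add_right (u v v' : Fin n → ℂ) : brC ρ u (v + v') = brC ρ u v + brC ρ u v' := by
  rw [brC_swap, brC_add_left, neg_add, ← brC_swap, ← brC_swap]

theorem brC_smul_right (c : ℂ) (u v : Fin n → ℂ) : brC ρ u (c • v) = c • brC ρ u v := by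
  rw [brC_swap, brC_smul_left, ← smul_neg, ← brC_swap]

theorem brC_single_single (k l : Fin n) : brC ρ (Pi.single k 1) (Pi.single l 1) = ρ (br k l) := by
  simp [brC, Pi.single_apply]

end

theorem forall_apply_mem_iff_forall_brC_mem {ρ : SpinRep n U} {W : Submodule ℂ U} :
    (∀ A, ∀ w ∈ W, ρ A w ∈ W) ↔ ∀ u v, ∀ w ∈ W, brC ρ u v w ∈ W := by
  refine ⟨fun h u v w hw => ?_, fun h A => ?_⟩
  · simp only [brC, LinearMap.sum_apply, LinearMap.smul_apply]
    exact W.sum_mem fun k _ => W.sum_mem fun l _ => W.smul_mem _ (h _ w hw)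
  · induction A using spinLie_induction with
    | br k l => exact brC_single_single ρ k l ▸ h _ _
    | zero => simp
    | add A B h₁ h₂ =>
      intro w hw
      rw [map_add]
      exact W.add_mem (h₁ w hw) (h₂ w hw)
    | smul c A h₁ =>
      intro w hw
      rw [SpinRep.smul_apply]
      exact W.smul_mem _ (h₁ w hw)

/-- `T` is an endomorphism of the representation `ρ`. -/
def IsEquivariant (ρ : SpinRep n U) (T : Module.End ℂ U) : Prop :=
  ∀ u v f, T (brC ρ u v f) = brC ρ u v (T f)

theorem IsEquivariant.map_apply {ρ : SpinRep n U} {T : Module.End ℂ U} (hT : IsEquivariant ρ T)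
    (A : spinLie n) : ∀ f, T (ρ A f) = ρ A (T f) := by
  induction A using spinLie_induction with
  | br k l => exact brC_single_single ρ k l ▸ hT _ _
  | zero => simp
  | add A B h₁ h₂ =>
    intro f
    rw [map_add, LinearMap.add_apply, LinearMap.add_apply, map_add, h₁, h₂]
  | smul c A h₁ =>
    intro f
    rw [SpinRep.smul_apply, SpinRep.smul_apply, map_smul, h₁]

theorem IsEquivariant.mul_add_smul_one {ρ : SpinRep n U} {S T : Module.End ℂ U}
    (hS : IsEquivariant ρ S) (hT : IsEquivariant ρ T) (c : ℂ) :
    IsEquivariant ρ (S * T + c • 1) := by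
  intro u v f
  change S (T (brC ρ u v f)) + c • brC ρ u v f = brC ρ u v (S (T f) + c • f)
  rw [hT, hS, map_add, map_smul]

namespace IsIrreducibleOn

variable {ρ : SpinRep n U} {W : Submodule ℂ U} (hW : IsIrreducibleOn ρ W) {T : Module.End ℂ U}
  (hT : IsEquivariant ρ T)
include hW hT

theorem apply_eq_zero {v : U} (hv : v ∈ W) (hv₀ : v ≠ 0) (hTv : T v = 0) : ∀ w ∈ W, T w = 0 := by
  rcases hW.eq_bot_or_eq (W ⊓ LinearMap.ker T) inf_le_left fun A w hw =>
    ⟨hW.invariant A w hw.1, by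
      change T (ρ A w) = 0
      rw [hT.map_apply, LinearMap.mem_ker.1 hw.2, map_zero]⟩ with h | h
  · have hmem : v ∈ W ⊓ LinearMap.ker T := ⟨hv, hTv⟩
    rw [h, Submodule.mem_bot] at hmem
    exact absurd hmem hv₀
  · exact fun w hw => (h.ge hw).2

theorem map (hinj : ∀ w ∈ W, T w = 0 → w = 0) : IsIrreducibleOn ρ (W.map T) where
  ne_bot h := by
    obtain ⟨w, hw, hw₀⟩ := (Submodule.ne_bot_iff _).1 hW.ne_bot
    have hTw : T w ∈ W.map T := Submodule.mem_map_of_mem hw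
    rw [h, Submodule.mem_bot] at hTw
    exact hw₀ (hinj w hw hTw)
  invariant := by
    rintro A _ ⟨w, hw, rfl⟩
    exact ⟨ρ A w, hW.invariant A w hw, hT.map_apply A w⟩
  eq_bot_or_eq W' hW' hinv := by
    have hmap : (W ⊓ W'.comap T).map T = W' := by
      rw [← Submodule.map_inf_eq_map_inf_comap]
      exact inf_eq_right.2 hW'
    rcases hW.eq_bot_or_eq (W ⊓ W'.comap T) inf_le_left fun A w hw =>
      ⟨hW.invariant A w hw.1, by
        change T (ρ A w) ∈ W'
        rw [hT.map_apply]
        exact hinv A _ hw.2⟩ with h | h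
    · exact Or.inl (by rw [← hmap, h, Submodule.map_bot])
    · exact Or.inr (by rw [← hmap, h])

end IsIrreducibleOn

theorem isQuotientOf_of_sup_eq {W₀ W₁ H K : Submodule ℂ U} (hdis : Disjoint W₀ W₁)
    (hsup : W₀ ⊔ W₁ = H) (hK : W₀ = H ⊓ K) : IsQuotientOf W₁ H K := by
  refine ⟨hsup ▸ le_sup_right, ?_, ?_⟩
  · rw [← LinearMap.ker_eq_bot, LinearMap.ker_eq_bot']
    intro w hw
    rw [LinearMap.comp_apply, Submodule.mkQ_apply, Submodule.Quotient.mk_eq_zero,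
      Submodule.submoduleOf, Submodule.mem_comap] at hw
    have hw₀ : (w : U) ∈ W₀ := hK ▸ ⟨hsup ▸ (le_sup_right : W₁ ≤ W₀ ⊔ W₁) w.2, hw⟩
    exact Subtype.ext (Submodule.disjoint_def.1 hdis _ hw₀ w.2)
  · intro y
    obtain ⟨⟨f, hf⟩, rfl⟩ := Submodule.mkQ_surjective _ y
    rw [← hsup] at hf
    obtain ⟨f₀, hf₀, f₁, hf₁, rfl⟩ := Submodule.mem_sup.1 hf
    refine ⟨⟨f₁, hf₁⟩, ?_⟩
    rw [LinearMap.comp_apply, Submodule.mkQ_apply, Submodule.mkQ_apply, Submodule.Quotient.eq,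
      Submodule.submoduleOf, Submodule.mem_comap]
    change f₁ - (f₀ + f₁) ∈ K
    rw [sub_add_cancel_right]
    exact K.neg_mem (hK.le hf₀).2

end SpinRepresentations

section CliffordAction

variable {n : ℕ} {V : Type*} [AddCommGroup V] [Module ℂ V] (γ : Cl n →ₐ[ℝ] Module.End ℂ V)

/-- Clifford multiplication by complex vectors. -/
def cliffordAction : (Fin n → ℂ) →ₗ[ℂ] Module.End ℂ V :=
  Fintype.linearCombination ℂ fun i => γ (e i)

theorem cliffordAction_single (i : Fin n) : cliffordAction γ (Pi.single i 1) = γ (e i) := by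
  rw [cliffordAction, Fintype.linearCombination_apply_single, one_smul]

theorem isCliffordMap_cliffordAction : IsCliffordMap (cliffordAction γ) := by
  intro u v
  have hee (k l : Fin n) : γ (e k) (γ (e l) v) + γ (e l) (γ (e k) v) =
      (if k = l then -2 else 0 : ℂ) • v := by
    have h := congrArg (fun a => γ a v) (e_mul_e_add (n := n) k l)
    simp only [map_add, map_mul, AlgHom.commutes, LinearMap.add_apply, Module.End.mul_apply,
      Module.algebraMap_end_apply] at h
    rw [h]
    split_ifs
    · change ((-2 : ℝ) : ℂ) • v = _
      norm_num
    · simp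
  have hsum := sum_sum_mul_smul_apply_apply (cliffordAction γ) (cliffordAction γ) u u v
  have hswap := hsum
  rw [Finset.sum_comm] at hswap
  refine smul_right_injective V (two_ne_zero (α := ℂ)) ?_
  change (2 : ℂ) • _ = (2 : ℂ) • _
  rw [two_smul ℂ (cliffordAction γ u _)]
  nth_rw 1 [← hsum]
  rw [← hswap, ← Finset.sum_add_distrib]
  simp only [← Finset.sum_add_distrib, cliffordAction_single, mul_comm (u _) (u _), ← smul_add, hee]
  simp [dotProduct, Finset.sum_smul, Finset.smul_sum, smul_comm (2 : ℂ)]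

theorem dirac_eq_diracOp : dirac γ = diracOp (dirDeriv V) (onValues (cliffordAction γ)) :=
  TensorProduct.ext' fun p v => by
    simp [dirac, diracOp_apply, cliffordAction_single, Pi.single_apply]

theorem cliffordX_eq_vecOp : cliffordX γ = vecOp (mulForm V) (onValues (cliffordAction γ)) :=
  TensorProduct.ext' fun p v => by
    simp [cliffordX, vecOp_apply, cliffordAction_single, Pi.single_apply]

theorem brC_spinorRep (u v : Fin n → ℂ) (y : V) : brC (spinorRep γ) u v y =
    cliffordAction γ u (cliffordAction γ v y) - cliffordAction γ v (cliffordAction γ u y) := by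
  rw [← sum_sum_mul_smul_apply_apply _ _ u v, ← sum_sum_mul_smul_apply_apply _ _ v u,
    Finset.sum_comm (f := fun k l => (v k * u l) • _), ← Finset.sum_sub_distrib]
  simp only [← Finset.sum_sub_distrib, brC, LinearMap.sum_apply, LinearMap.smul_apply,
    mul_comm (v _), ← smul_sub, cliffordAction_single]
  refine Finset.sum_congr rfl fun k _ => Finset.sum_congr rfl fun l _ => ?_
  change (u k * v l) • γ ⁅(e k : Cl n), e l⁆ y = _
  rw [Ring.lie_def, map_sub, map_mul, map_mul]
  rfl

theorem brC_polyRep_tmul (u v : Fin n → ℂ) (p : MvPolynomial (Fin n) ℂ) (y : V) :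
    (brC (polyRep n) u v p) ⊗ₜ[ℂ] y = (4 : ℂ) •
      (mulForm V v (dirDeriv V u (p ⊗ₜ y)) - mulForm V u (dirDeriv V v (p ⊗ₜ y))) := by
  rw [← sum_sum_mul_smul_apply_apply (mulForm V) _ u v,
    ← sum_sum_mul_smul_apply_apply (mulForm V) _ v u,
    Finset.sum_comm (f := fun k l => (v k * u l) • _), ← Finset.sum_sub_distrib, Finset.smul_sum]
  simp only [← Finset.sum_sub_distrib, brC, LinearMap.sum_apply, LinearMap.smul_apply,
    mul_comm (v _), Finset.smul_sum, TensorProduct.sum_tmul]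
  refine Finset.sum_congr rfl fun k _ => Finset.sum_congr rfl fun l _ => ?_
  rw [polyRep_br, ← map_ofNat MvPolynomial.C 4, ← MvPolynomial.smul_eq_C_mul, neg_add_eq_sub,
    ← TensorProduct.smul_tmul', ← TensorProduct.smul_tmul', TensorProduct.sub_tmul]
  simp only [mulForm_tmul, dirDeriv_tmul, Pi.single_apply, ite_smul, one_smul, zero_smul,
    Finset.sum_ite_eq', Finset.mem_univ, if_true]
  change (u k * v l) • (4 : ℂ) • _ = _
  module

theorem brC_tensorRep_tmul {U : Type*} [AddCommGroup U] [Module ℂ U] (ρ : SpinRep n U)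
    (σ : SpinRep n V) (u v : Fin n → ℂ) (f : U) (y : V) : brC (tensorRep ρ σ) u v (f ⊗ₜ[ℂ] y) =
      (brC ρ u v f) ⊗ₜ y + f ⊗ₜ brC σ u v y := by
  simp [brC, tensorRep, TensorProduct.sum_tmul, TensorProduct.tmul_sum, Finset.sum_add_distrib,
    TensorProduct.smul_tmul', TensorProduct.tmul_smul]

theorem brC_spinorPolyRep (u v : Fin n → ℂ) : brC (spinorPolyRep γ) u v =
    rotOp (mulForm V) (dirDeriv V) (onValues (cliffordAction γ)) u v := by
  refine TensorProduct.ext' fun p y => ?_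
  rw [spinorPolyRep, brC_tensorRep_tmul, brC_polyRep_tmul, brC_spinorRep, rotOp_apply,
    TensorProduct.tmul_sub]
  rfl

end CliffordAction

/-! ### Highest weights -/

section WeightVectors

variable {m : ℕ} {i j : Fin m}

@[simp] theorem idxA_inj : idxA i = idxA j ↔ i = j := by
  simp [idxA, Fin.ext_iff]

@[simp] theorem idxB_inj : idxB i = idxB j ↔ i = j := by
  simp [idxB, Fin.ext_iff]

@[simp] theorem idxA_ne_idxB : idxA i ≠ idxB j := by
  simp only [idxA, idxB, ne_eq, Fin.mk.injEq]
  omega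

@[simp] theorem idxB_ne_idxA : idxB i ≠ idxA j := idxA_ne_idxB.symm

@[simp] theorem idxA_ne_last : idxA i ≠ Fin.last (2 * m) := by
  simp only [idxA, ne_eq, Fin.ext_iff, Fin.val_last]
  omega

@[simp] theorem idxB_ne_last : idxB i ≠ Fin.last (2 * m) := by
  simp only [idxB, ne_eq, Fin.ext_iff, Fin.val_last]
  omega

theorem eq_idxA_or_eq_idxB_or_eq_last (k : Fin (2 * m + 1)) :
    (∃ j, k = idxA j) ∨ (∃ j, k = idxB j) ∨ k = Fin.last (2 * m) := by
  by_cases hlast : (k : ℕ) = 2 * m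
  · exact Or.inr (Or.inr (Fin.ext hlast))
  · rcases Nat.even_or_odd' k with ⟨l, hl | hl⟩
    · exact Or.inl ⟨⟨l, by omega⟩, Fin.ext hl⟩
    · exact Or.inr (Or.inl ⟨⟨l, by omega⟩, Fin.ext hl⟩)

theorem compl_idxA_idxB_nonempty (j : Fin m) :
    ({idxA j, idxB j}ᶜ : Finset (Fin (2 * m + 1))).Nonempty :=
  ⟨Fin.last (2 * m), by simp [idxA_ne_last.symm, idxB_ne_last.symm]⟩

theorem wPos_dotProduct (j : Fin m) (v : Fin (2 * m + 1) → ℂ) :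
    wPos j ⬝ᵥ v = v (idxA j) - Complex.I * v (idxB j) := by
  simp [wPos, sub_dotProduct]

theorem wNeg_dotProduct (j : Fin m) (v : Fin (2 * m + 1) → ℂ) :
    wNeg j ⬝ᵥ v = v (idxA j) + Complex.I * v (idxB j) := by
  simp [wNeg, add_dotProduct]

theorem wPos_dotProduct_wPos (i j : Fin m) : wPos i ⬝ᵥ wPos j = 0 := by
  rw [wPos_dotProduct]
  by_cases h : i = j
  · simp [wPos, h]
  · simp [wPos, h]

theorem wNeg_dotProduct_wPos (i j : Fin m) : wNeg i ⬝ᵥ wPos j = if i = j then 2 else 0 := by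
  rw [wNeg_dotProduct]
  by_cases h : i = j
  · simp [wPos, h, one_add_one_eq_two]
  · simp [wPos, h]

theorem wPos_dotProduct_wZero (i : Fin m) : wPos i ⬝ᵥ wZero m = 0 := by
  rw [wPos_dotProduct]
  simp [wZero]

theorem wittFrame_wPos_wNeg (j : Fin m) :
    WittFrame (wPos j) (wNeg j) {idxA j, idxB j}ᶜ where
  dot_self_left := wPos_dotProduct_wPos j j
  dot_self_right := by rw [wNeg_dotProduct]; simp [wNeg]
  dot := by rw [dotProduct_comm, wNeg_dotProduct_wPos, if_pos rfl]
  left_apply k hk := by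
    have : k ≠ idxA j ∧ k ≠ idxB j := by simpa using hk
    simp [wPos, this]
  right_apply k hk := by
    have : k ≠ idxA j ∧ k ≠ idxB j := by simpa using hk
    simp [wNeg, this]
  two_smul_eq u := by
    ext k
    have hsum : (∑ l ∈ {idxA j, idxB j}ᶜ, u l • Pi.single l (1 : ℂ)) k =
        if k = idxA j ∨ k = idxB j then 0 else u k := by
      by_cases hA : k = idxA j <;> by_cases hB : k = idxB j <;> simp [Pi.single_apply, hA, hB]
    rw [wNeg_dotProduct, wPos_dotProduct]
    simp only [wPos, wNeg, Pi.smul_apply, Pi.add_apply, Pi.sub_apply, hsum, Pi.single_apply,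
      smul_eq_mul]
    by_cases hA : k = idxA j
    · subst hA
      simp only [idxA_ne_idxB, if_true, if_false, true_or]
      ring
    by_cases hB : k = idxB j
    · subst hB
      simp only [idxB_ne_idxA, if_true, if_false, or_true]
      linear_combination (2 * u (idxB j)) * Complex.I_mul_I
    · simp [hA, hB]

end WeightVectors

section HighestWeights

variable {m : ℕ} {U : Type*} [AddCommGroup U] [Module ℂ U] {ρ : SpinRep (2 * m + 1) U}

theorem brC_wNeg_wPos (ρ : SpinRep (2 * m + 1) U) (j : Fin m) :
    brC ρ (wNeg j) (wPos j) = (-2 * Complex.I) • ρ (br (idxA j) (idxB j)) := by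
  rw [wNeg, wPos, sub_eq_add_neg, ← neg_smul]
  simp only [brC_add_left, brC_add_right, brC_smul_left, brC_smul_right, brC_single_single, br_self,
    br_swap (idxA j) (idxB j), map_neg, map_zero]
  module

theorem br_apply_eq_iff_brC_apply_eq {j : Fin m} {c : ℂ} {v : U} :
    ρ (br (idxA j) (idxB j)) v = (4 * Complex.I * c) • v ↔
      brC ρ (wNeg j) (wPos j) v = (8 * c) • v := by
  have hI : -2 * Complex.I ≠ 0 := by simp
  have h8 : 8 * c = -2 * Complex.I * (4 * Complex.I * c) := by
    linear_combination (8 * c) * Complex.I_mul_I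
  rw [brC_wNeg_wPos, LinearMap.smul_apply, h8, mul_smul (-2 * Complex.I),
    (smul_right_injective U hI).eq_iff]

namespace IsHighestWeightVector

variable {wt : Fin m → ℝ} {v : U} (hv : IsHighestWeightVector ρ wt v)
include hv

theorem map {T : Module.End ℂ U} (hT : IsEquivariant ρ T) (hTv : T v ≠ 0) :
    IsHighestWeightVector ρ wt (T v) where
  ne_zero := hTv
  weight j := by rw [← hT.map_apply, hv.weight, map_smul]
  root_add i j hij := by rw [← hT, hv.root_add i j hij, map_zero]
  root_sub i j hij := by rw [← hT, hv.root_sub i j hij, map_zero]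
  root_short i := by rw [← hT, hv.root_short i, map_zero]

theorem brC_wPos_single_apply {i : Fin m} (hi : ∀ j, j ≠ i → i < j) {k : Fin (2 * m + 1)}
    (hk : k ∈ ({idxA i, idxB i}ᶜ : Finset _)) : brC ρ (wPos i) (Pi.single k 1) v = 0 := by
  obtain ⟨hkA, hkB⟩ : k ≠ idxA i ∧ k ≠ idxB i := by simpa using hk
  rcases eq_idxA_or_eq_idxB_or_eq_last k with ⟨j, rfl⟩ | ⟨j, rfl⟩ | rfl
  · have hij := hi j (by rintro rfl; exact hkA rfl)
    have hsum : Pi.single (idxA j) 1 = (2⁻¹ : ℂ) • (wPos j + wNeg j) := by rw [wPos, wNeg]; module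
    rw [hsum, brC_smul_right, brC_add_right, LinearMap.smul_apply, LinearMap.add_apply,
      hv.root_add i j hij, hv.root_sub i j hij, add_zero, smul_zero]
  · have hij := hi j (by rintro rfl; exact hkB rfl)
    have hsum : Pi.single (idxB j) 1 = (2⁻¹ * Complex.I) • (wPos j + (-1 : ℂ) • wNeg j) := by
      rw [wPos, wNeg]
      linear_combination (norm := module) Complex.I_mul_I • Pi.single (idxB j) (1 : ℂ)
    rw [hsum, brC_smul_right, brC_add_right, brC_smul_right, LinearMap.smul_apply,
      LinearMap.add_apply, LinearMap.smul_apply, hv.root_add i j hij, hv.root_sub i j hij,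
      smul_zero, add_zero, smul_zero]
  · exact hv.root_short i

end IsHighestWeightVector

theorem IsIrrepOfHighestWeight.map {wt : Fin m → ℝ} {W : Submodule ℂ U}
    (hW : IsIrrepOfHighestWeight ρ wt W) {T : Module.End ℂ U} (hT : IsEquivariant ρ T)
    (hinj : ∀ w ∈ W, T w = 0 → w = 0) : IsIrrepOfHighestWeight ρ wt (W.map T) := by
  obtain ⟨hirr, v, hvW, hv⟩ := hW
  exact ⟨hirr.map hT hinj, T v, Submodule.mem_map_of_mem hvW,
    hv.map hT fun h => hv.ne_zero (hinj v hvW h)⟩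

end HighestWeights

section SpinorModules

variable {n : ℕ} {V : Type*} [AddCommGroup V] [Module ℂ V] {γ : Cl n →ₐ[ℝ] Module.End ℂ V}

theorem IsSpinorModule.isIrreducibleMap (hγ : IsSpinorModule γ) :
    IsIrreducibleMap (cliffordAction γ) := by
  refine fun W hW => hγ.eq_bot_or_eq_top W fun a => ?_
  induction a using CliffordAlgebra.induction with
  | algebraMap r =>
    intro w hw
    rw [AlgHom.commutes, Module.algebraMap_end_apply]
    exact W.smul_mem (r : ℂ) hw
  | ι x =>
    intro w hw
    have hx : CliffordAlgebra.ι (negForm n) x = ∑ i, x i • e i := by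
      conv_lhs => rw [pi_eq_sum_univ' x]
      simp only [map_sum, map_smul, e]
    rw [hx, map_sum, LinearMap.sum_apply]
    refine W.sum_mem fun i _ => ?_
    rw [map_smul, ← cliffordAction_single]
    exact W.smul_mem (x i : ℂ) (hW _ w hw)
  | mul a b ha hb =>
    intro w hw
    rw [map_mul]
    exact ha _ (hb w hw)
  | add a b ha hb =>
    intro w hw
    rw [map_add]
    exact W.add_mem (ha w hw) (hb w hw)

theorem brC_spinorPolyRep_mulForm_pow {u v w : Fin n → ℂ} {c : ℂ} (hw : rotVec u v w = c • w)
    (q : ℕ) (y : V) : brC (spinorPolyRep γ) u v ((mulForm V w ^ q) (1 ⊗ₜ y)) =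
      (mulForm V w ^ q) (1 ⊗ₜ brC (spinorRep γ) u v y) +
        (q * c) • (mulForm V w ^ q) (1 ⊗ₜ y) := by
  rw [brC_spinorPolyRep, (isCliffordMap_cliffordAction γ).weylClifford.rotOp_pow_X hw,
    rotOp_one_tmul, brC_spinorRep]

end SpinorModules

section SpinorWeights

variable {m : ℕ} {V : Type*} [AddCommGroup V] [Module ℂ V]
  {γ : Cl (2 * m + 1) →ₐ[ℝ] Module.End ℂ V}

theorem isHighestWeightVector_wtSpin {y : V} (hy₀ : y ≠ 0)
    (hy : ∀ j, cliffordAction γ (wPos j) y = 0) :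
    IsHighestWeightVector (spinorRep γ) (wtSpin m) y := by
  have hg := isCliffordMap_cliffordAction γ
  have hroot {i : Fin m} {v : Fin (2 * m + 1) → ℂ} (hv : wPos i ⬝ᵥ v = 0) :
      brC (spinorRep γ) (wPos i) v y = 0 := by
    rw [brC_spinorRep, hg.anticomm hv, hy, map_zero, neg_zero, sub_zero]
  exact {
    ne_zero := hy₀
    weight := fun j => br_apply_eq_iff_brC_apply_eq.2 <| by
      rw [brC_spinorRep, hy, map_zero, hg.apply_left_apply_right (wittFrame_wPos_wNeg j) (hy j),
        wtSpin]
      push_cast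
      module
    root_add := fun i j _ => hroot (wPos_dotProduct_wPos i j)
    root_sub := fun i j hij => hroot <| by
      rw [dotProduct_comm, wNeg_dotProduct_wPos, if_neg hij.ne']
    root_short := fun i => hroot (wPos_dotProduct_wZero i) }

theorem exists_isHighestWeightVector_wtSpin [Nontrivial V] :
    ∃ y, IsHighestWeightVector (spinorRep γ) (wtSpin m) y ∧
      ∀ j, cliffordAction γ (wPos j) y = 0 := by
  have hg := isCliffordMap_cliffordAction γ
  obtain ⟨y, hy₀, hy⟩ := exists_ne_zero_forall_apply_eq_zero_of_anticomm
    (T := fun j => cliffordAction γ (wPos j))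
    (fun i j v => hg.anticomm (wPos_dotProduct_wPos i j) v)
    (fun i v => hg.apply_self_of_isotropic (wPos_dotProduct_wPos i i) v) Finset.univ
  have hy' := fun j => hy j (Finset.mem_univ j)
  exact ⟨y, isHighestWeightVector_wtSpin hy₀ hy', hy'⟩

variable [NeZero m]

theorem IsHighestWeightVector.mulForm_pow {wt : Fin m → ℝ} {y : V}
    (hy : IsHighestWeightVector (spinorRep γ) wt y) (q : ℕ) :
    IsHighestWeightVector (spinorPolyRep γ) (wt + Pi.single 0 (q : ℝ))
      ((mulForm V (wPos 0) ^ q) (1 ⊗ₜ y)) := by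
  have hroot {i : Fin m} {v : Fin (2 * m + 1) → ℂ} (hv : v ⬝ᵥ wPos 0 = 0)
      (hroot_y : brC (spinorRep γ) (wPos i) v y = 0) :
      brC (spinorPolyRep γ) (wPos i) v ((mulForm V (wPos 0) ^ q) (1 ⊗ₜ y)) = 0 := by
    rw [brC_spinorPolyRep_mulForm_pow (c := 0) (by simp [rotVec, hv, wPos_dotProduct_wPos]),
      hroot_y]
    simp
  have hrotVec (j : Fin m) :
      rotVec (wNeg j) (wPos j) (wPos 0) = (if j = 0 then 8 else 0 : ℂ) • wPos 0 := by
    rw [rotVec, wNeg_dotProduct_wPos, wPos_dotProduct_wPos]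
    split_ifs with hj
    · rw [hj]; module
    · module
  exact {
    ne_zero := by
      rw [map_ne_zero_iff _ (mulForm_pow_injective (wittFrame_wPos_wNeg 0).left_ne_zero q)]
      exact fun h => hy.ne_zero (one_tmul_injective (h.trans (TensorProduct.tmul_zero _ _).symm))
    weight := fun j => br_apply_eq_iff_brC_apply_eq.2 <| by
      rw [brC_spinorPolyRep_mulForm_pow (hrotVec j), br_apply_eq_iff_brC_apply_eq.1 (hy.weight j),
        TensorProduct.tmul_smul, map_smul, Pi.add_apply, Pi.single_apply]
      split_ifs <;> push_cast <;> module
    root_add := fun i j hij => hroot (wPos_dotProduct_wPos j 0) (hy.root_add i j hij)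
    root_sub := fun i j hij => hroot
      (by rw [wNeg_dotProduct_wPos, if_neg (i.zero_le.trans_lt hij).ne']) (hy.root_sub i j hij)
    root_short := fun i => hroot (by rw [dotProduct_comm, wPos_dotProduct_wZero])
      (hy.root_short i) }

local notation "𝓜[" γ "]" => monogenic (mulForm _) (dirDeriv _) (onValues (cliffordAction γ))

variable {wt : Fin m → ℝ} {p : ℕ}

theorem IsHighestWeightVector.weight_zero_eq {f : MvPolynomial (Fin (2 * m + 1)) ℂ ⊗[ℂ] V}
    (hf : IsHighestWeightVector (spinorPolyRep γ) wt f) (hfp : f ∈ 𝓜[γ] p) :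
    wt 0 = p + 1 / 2 := by
  have hg := isCliffordMap_cliffordAction γ
  have fr := wittFrame_wPos_wNeg (0 : Fin m)
  obtain ⟨y, hy, hfy⟩ := hg.exists_eq_mulForm_pow_of_rotOp_eq_zero fr
    (compl_idxA_idxB_nonempty 0) hfp fun k hk => by
      rw [← brC_spinorPolyRep]
      exact hf.brC_wPos_single_apply (fun j => Fin.pos_iff_ne_zero.2) hk
  have hweight := br_apply_eq_iff_brC_apply_eq.1 (hf.weight 0)
  rw [brC_spinorPolyRep, hfy, hg.rotOp_mulForm_pow fr hy, ← hfy] at hweight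
  have heq := mul_left_cancel₀ (by norm_num) (smul_left_injective ℂ hf.ne_zero hweight)
  refine Complex.ofReal_injective (heq.symm.trans ?_)
  push_cast
  rfl

theorem IsIrrepOfHighestWeight.apply_eq_zero {T : Module.End ℂ _}
    {W : Submodule ℂ (MvPolynomial (Fin (2 * m + 1)) ℂ ⊗[ℂ] V)}
    (hW : IsIrrepOfHighestWeight (spinorPolyRep γ) wt W) (hT : IsEquivariant (spinorPolyRep γ) T)
    (hTW : ∀ w ∈ W, T w ∈ 𝓜[γ] p) (hwt : wt 0 ≠ p + 1 / 2) : ∀ w ∈ W, T w = 0 := by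
  obtain ⟨hirr, v, hvW, hv⟩ := hW
  refine hirr.apply_eq_zero hT hvW hv.ne_zero ?_
  by_contra hTv
  exact hwt ((hv.map hT hTv).weight_zero_eq (hTW v hvW))

end SpinorWeights

/-! ### The decomposition of harmonic spinors -/

section HarmonicSpinors

local notation "𝓜[" g "]" => monogenic (mulForm _) (dirDeriv _) (onValues g)
local notation "𝓓[" g "]" => diracOp (dirDeriv _) (onValues g)
local notation "𝓧[" g "]" => vecOp (mulForm _) (onValues g)

namespace IsCliffordMap

variable {n q : ℕ} {V : Type*} [AddCommGroup V] [Module ℂ V]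
  {g : (Fin n → ℂ) →ₗ[ℂ] Module.End ℂ V} (hg : IsCliffordMap g)
  {f : MvPolynomial (Fin n) ℂ ⊗[ℂ] V}
include hg

theorem mem_harmonicTensor_iff : f ∈ harmonicTensor n q V ↔
    𝓓[g] (𝓓[g] f) = 0 ∧ eulerOp (mulForm V) (dirDeriv V) f = (q : ℂ) • f := by
  have hlap : 𝓓[g] (𝓓[g] f) = -lapOp (dirDeriv V) f := by
    refine smul_right_injective _ (two_ne_zero (α := ℂ)) ?_
    change (2 : ℂ) • _ = (2 : ℂ) • _
    rw [hg.weylClifford.two_smul_dirac_dirac, smul_neg, neg_smul]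
  rw [hlap, neg_eq_zero, mem_harmonicTensor, and_comm]

theorem monogenic_eq_inf_ker : 𝓜[g] q = harmonicTensor n q V ⊓ LinearMap.ker 𝓓[g] := by
  ext f
  rw [Submodule.mem_inf, hg.mem_harmonicTensor_iff, LinearMap.mem_ker, mem_monogenic]
  exact ⟨fun h => ⟨⟨by rw [h.1, map_zero], h.2⟩, h.1⟩, fun h => ⟨h.2, h.1.2⟩⟩

theorem dirac_mem_monogenic (hf : f ∈ harmonicTensor n (q + 1) V) : 𝓓[g] f ∈ 𝓜[g] q := by
  obtain ⟨hDD, hE⟩ := hg.mem_harmonicTensor_iff.1 hf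
  refine mem_monogenic.2 ⟨hDD, ?_⟩
  rw [hg.weylClifford.euler_dirac_of_eq hE, Nat.cast_succ, add_sub_cancel_right]

theorem harmonicTensor_zero : harmonicTensor n 0 V = 𝓜[g] 0 := by
  rw [hg.monogenic_eq_inf_ker, eq_comm, inf_eq_left]
  intro f hf
  refine eq_zero_of_not_hasEigenvalue hg.not_hasEigenvalue_eulerOp ?_
  rw [hg.weylClifford.euler_dirac_of_eq (hg.mem_harmonicTensor_iff.1 hf).2, Nat.cast_zero, zero_sub]

theorem dirac_vec_of_mem_monogenic (hf : f ∈ 𝓜[g] q) :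
    𝓓[g] (𝓧[g] f) = -(n + 2 * q : ℂ) • f := by
  obtain ⟨hD, hE⟩ := mem_monogenic.1 hf
  rw [hg.weylClifford.dirac_vec, hD, hE, map_zero, Fintype.card_fin]
  module

theorem vec_mem_harmonicTensor (hf : f ∈ 𝓜[g] q) : 𝓧[g] f ∈ harmonicTensor n (q + 1) V := by
  obtain ⟨hD, hE⟩ := mem_monogenic.1 hf
  rw [hg.mem_harmonicTensor_iff, hg.dirac_vec_of_mem_monogenic hf, map_smul, hD, smul_zero,
    hg.weylClifford.euler_vec_of_eq hE, Nat.cast_succ]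
  exact ⟨rfl, rfl⟩

theorem vec_dirac_add_mem_monogenic (hf : f ∈ harmonicTensor n q V) :
    𝓧[g] (𝓓[g] f) + (n + 2 * q - 2 : ℂ) • f ∈ 𝓜[g] q := by
  obtain ⟨hDD, hE⟩ := hg.mem_harmonicTensor_iff.1 hf
  have hED := hg.weylClifford.euler_dirac_of_eq hE
  rw [mem_monogenic, map_add, map_add, map_smul, map_smul, hg.weylClifford.dirac_vec,
    hg.weylClifford.euler_vec_of_eq hED, hDD, hED, hE, map_zero, Fintype.card_fin]
  exact ⟨by module, by module⟩

variable [NeZero n]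

omit hg in
theorem natCast_add_two_mul_ne_zero (n q : ℕ) [NeZero n] : (n + 2 * q : ℂ) ≠ 0 := by
  exact_mod_cast (Nat.add_pos_left (NeZero.pos n) _).ne'

theorem eq_zero_of_dirac_vec_eq_zero (hf : f ∈ 𝓜[g] q) (hDx : 𝓓[g] (𝓧[g] f) = 0) : f = 0 := by
  rw [hg.dirac_vec_of_mem_monogenic hf, smul_eq_zero, neg_eq_zero] at hDx
  exact hDx.resolve_left (natCast_add_two_mul_ne_zero n q)

theorem disjoint_monogenic_map_vec : Disjoint (𝓜[g] (q + 1)) ((𝓜[g] q).map 𝓧[g]) := by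
  rw [Submodule.disjoint_def]
  rintro _ hxf ⟨f, hf, rfl⟩
  rw [hg.eq_zero_of_dirac_vec_eq_zero hf (mem_monogenic.1 hxf).1, map_zero]

theorem monogenic_sup_map_vec :
    𝓜[g] (q + 1) ⊔ (𝓜[g] q).map 𝓧[g] = harmonicTensor n (q + 1) V := by
  refine le_antisymm (sup_le (hg.monogenic_eq_inf_ker.trans_le inf_le_left) ?_) fun f hf => ?_
  · rintro _ ⟨f, hf, rfl⟩
    exact hg.vec_mem_harmonicTensor hf
  · have hc := natCast_add_two_mul_ne_zero n q
    have hproj := hg.vec_dirac_add_mem_monogenic hf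
    have hc' : (n + 2 * (q + 1 : ℕ) - 2 : ℂ) = n + 2 * q := by push_cast; ring
    rw [hc'] at hproj
    refine (Submodule.smul_mem_iff _ hc).1 ?_
    rw [← sub_add_cancel ((n + 2 * q : ℂ) • f) (-𝓧[g] (𝓓[g] f)), sub_neg_eq_add,
      add_comm _ (𝓧[g] _)]
    exact Submodule.add_mem_sup hproj
      (Submodule.neg_mem _ (Submodule.mem_map_of_mem (hg.dirac_mem_monogenic hf)))

end IsCliffordMap
variable {m : ℕ} {V : Type*} [AddCommGroup V] [Module ℂ V]

theorem IsSpinorModule.isIrrepOfHighestWeight_spinorRep [FiniteDimensional ℂ V]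
    {γ : Cl (2 * m + 1) →ₐ[ℝ] Module.End ℂ V} (hγ : IsSpinorModule γ) :
    IsIrrepOfHighestWeight (spinorRep γ) (wtSpin m) ⊤ := by
  have hV := hγ.nontrivial
  have hg := isCliffordMap_cliffordAction γ
  obtain ⟨y, hy, -⟩ := exists_isHighestWeightVector_wtSpin (γ := γ)
  refine ⟨⟨top_ne_bot, fun _ _ _ => trivial, fun W _ hinv => ?_⟩, y, trivial, hy⟩
  refine hg.eq_bot_or_eq_top_of_even hγ.isIrreducibleMap (by simp) fun u v w hw => ?_
  have hcomm := forall_apply_mem_iff_forall_brC_mem.1 hinv u v w hw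
  have hprod : cliffordAction γ u (cliffordAction γ v w) =
      (2 : ℂ)⁻¹ • brC (spinorRep γ) u v w - (u ⬝ᵥ v) • w := by
    rw [brC_spinorRep, hg.apply_apply v, dotProduct_comm v]
    module
  rw [hprod]
  exact W.sub_mem (W.smul_mem _ hcomm) (W.smul_mem _ hw)

theorem wtHook_add_half [NeZero m] (a : ℝ) : wtHook m (a + 1 / 2) = wtSpin m + Pi.single 0 a := by
  funext j
  by_cases hj : j = 0
  · simp [wtHook, wtSpin, hj, add_comm]
  · simp [wtHook, wtSpin, hj]

variable {γ : Cl (2 * m + 1) →ₐ[ℝ] Module.End ℂ V}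

theorem isEquivariant_vecOp : IsEquivariant (spinorPolyRep γ) 𝓧[cliffordAction γ] := by
  intro u v f
  rw [brC_spinorPolyRep]
  exact (isCliffordMap_cliffordAction γ).weylClifford.vec_rot u v f

theorem isEquivariant_diracOp : IsEquivariant (spinorPolyRep γ) 𝓓[cliffordAction γ] := by
  intro u v f
  rw [brC_spinorPolyRep]
  exact (isCliffordMap_cliffordAction γ).weylClifford.dirac_rot u v f

variable [NeZero m]

theorem IsSpinorModule.isIrrepOfHighestWeight_monogenic [FiniteDimensional ℂ V]
    (hγ : IsSpinorModule γ) (q : ℕ) :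
    IsIrrepOfHighestWeight (spinorPolyRep γ) (wtHook m (q + 1 / 2)) (𝓜[cliffordAction γ] q) := by
  have hV := hγ.nontrivial
  have hg := isCliffordMap_cliffordAction γ
  obtain ⟨y, hy, hvac⟩ := exists_isHighestWeightVector_wtSpin (γ := γ)
  have hconst : (1 : MvPolynomial (Fin (2 * m + 1)) ℂ) ⊗ₜ[ℂ] y ∈ 𝓜[cliffordAction γ] 0 := by
    simp [mem_monogenic, diracOp_apply, eulerOp_apply]
  have hmem := hg.weylClifford.X_pow_mem_monogenic (u := wPos 0) hconst
    (by rw [onValues_tmul, hvac, TensorProduct.tmul_zero]) q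
  rw [zero_add] at hmem
  have hv := wtHook_add_half (m := m) q ▸ hy.mulForm_pow q
  refine ⟨⟨(Submodule.ne_bot_iff _).2 ⟨_, hmem, hv.ne_zero⟩,
    forall_apply_mem_iff_forall_brC_mem.2 fun u v f hf => ?_, fun W hW hinv => ?_⟩, _, hmem, hv⟩
  · rw [brC_spinorPolyRep]
    exact hg.rotOp_mem_monogenic u v hf
  · refine or_iff_not_imp_left.2 fun hW₀ => ?_
    rw [forall_apply_mem_iff_forall_brC_mem] at hinv
    simp only [brC_spinorPolyRep] at hinv
    exact hg.eq_monogenic_of_rotOp_mem (wittFrame_wPos_wNeg 0) (compl_idxA_idxB_nonempty 0)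
      hγ.isIrreducibleMap (by simp) hW₀ hW hinv

theorem IsSpinorModule.exists_isSpinorDecomposition [FiniteDimensional ℂ V]
    (hγ : IsSpinorModule γ) (q : ℕ) : ∃ W₀ W₁, IsSpinorDecomposition γ q W₀ W₁ := by
  have hg := isCliffordMap_cliffordAction γ
  have hirr := hγ.isIrrepOfHighestWeight_monogenic
  cases q with
  | zero =>
    exact ⟨_, ⊥, hirr 0, fun h => absurd h (Nat.not_succ_le_zero 0), fun _ => rfl,
      disjoint_bot_right, by rw [sup_bot_eq, hg.harmonicTensor_zero]⟩
  | succ q =>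
    refine ⟨_, _, hirr (q + 1), fun _ => ?_, fun h => absurd h q.succ_ne_zero,
      hg.disjoint_monogenic_map_vec, hg.monogenic_sup_map_vec⟩
    have hweight : ((q + 1 : ℕ) : ℝ) - 1 / 2 = q + 1 / 2 := by push_cast; ring
    rw [hweight]
    exact (hirr q).map isEquivariant_vecOp fun f hf hxf =>
      hg.eq_zero_of_dirac_vec_eq_zero hf (by rw [hxf, map_zero])

namespace IsSpinorDecomposition

variable {q : ℕ} {W₀ W₁ : Submodule ℂ (MvPolynomial (Fin (2 * m + 1)) ℂ ⊗[ℂ] V)}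
  (hdec : IsSpinorDecomposition γ q W₀ W₁)
include hdec

theorem dirac_eq_zero : ∀ f ∈ W₀, 𝓓[cliffordAction γ] f = 0 := by
  have hg := isCliffordMap_cliffordAction γ
  have hH : W₀ ≤ harmonicTensor (2 * m + 1) q V := le_sup_left.trans hdec.sup_eq.le
  cases q with
  | zero => exact fun f hf => (mem_monogenic.1 (hg.harmonicTensor_zero.le (hH hf))).1
  | succ q =>
    refine hdec.irrep₀.apply_eq_zero isEquivariant_diracOp
      (fun f hf => hg.dirac_mem_monogenic (hH hf)) ?_
    simp [wtHook]

theorem eq_monogenic [FiniteDimensional ℂ V] (hγ : IsSpinorModule γ) :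
    W₀ = 𝓜[cliffordAction γ] q := by
  have hle : W₀ ≤ 𝓜[cliffordAction γ] q := by
    rw [(isCliffordMap_cliffordAction γ).monogenic_eq_inf_ker]
    exact le_inf (le_sup_left.trans hdec.sup_eq.le) hdec.dirac_eq_zero
  exact ((hγ.isIrrepOfHighestWeight_monogenic q).1.eq_bot_or_eq W₀ hle
    hdec.irrep₀.1.invariant).resolve_left hdec.irrep₀.1.ne_bot

theorem vec_dirac : ∀ f ∈ W₁, -𝓧[cliffordAction γ] (𝓓[cliffordAction γ] f) =
    (((2 * m + 1 : ℕ) : ℂ) + 2 * (q : ℂ) - 2) • f := by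
  have hg := isCliffordMap_cliffordAction γ
  have hH : W₁ ≤ harmonicTensor (2 * m + 1) q V := le_sup_right.trans hdec.sup_eq.le
  let c : ℂ := ((2 * m + 1 : ℕ) : ℂ) + 2 * (q : ℂ) - 2
  intro f hf
  rcases Nat.eq_zero_or_pos q with hq | hq
  · rw [hdec.absent hq, Submodule.mem_bot] at hf
    simp [hf]
  have hT : IsEquivariant (spinorPolyRep γ) (𝓧[cliffordAction γ] * 𝓓[cliffordAction γ] + c • 1) :=
    isEquivariant_vecOp.mul_add_smul_one isEquivariant_diracOp c
  have hTf := (hdec.irrep₁ hq).apply_eq_zero hT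
    (fun u hu => hg.vec_dirac_add_mem_monogenic (hH hu))
    (by simp only [wtHook, Fin.val_zero, if_true, ne_eq]; linarith) f hf
  exact (eq_neg_of_add_eq_zero_right hTf).symm

end IsSpinorDecomposition

end HarmonicSpinors

end

end SpinorHarmonic

open SpinorHarmonic in
theorem mainTheorem5 (m q : ℕ) (hm : 1 ≤ m)
    {V : Type*} [AddCommGroup V] [Module ℂ V] [FiniteDimensional ℂ V]
    (γ : Cl (2 * m + 1) →ₐ[ℝ] Module.End ℂ V) (hγ : IsSpinorModule γ) :
    IsIrrepOfHighestWeight (spinorRep γ) (wtSpin m) ⊤ ∧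
    (∃ W₀ W₁, IsSpinorDecomposition γ q W₀ W₁) ∧
    ∀ W₀ W₁, IsSpinorDecomposition γ q W₀ W₁ →
      (∀ f ∈ W₀, -(cliffordX γ (dirac γ f)) = 0) ∧
      (∀ f ∈ W₁, -(cliffordX γ (dirac γ f)) =
        (((2 * m + 1 : ℕ) : ℂ) + 2 * (q : ℂ) - 2) • f) ∧
      W₀ = harmonicTensor (2 * m + 1) q V ⊓ LinearMap.ker (dirac γ) ∧
      IsQuotientOf W₁ (harmonicTensor (2 * m + 1) q V) (LinearMap.ker (dirac γ)) := by
  have : NeZero m := ⟨by omega⟩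
  refine ⟨hγ.isIrrepOfHighestWeight_spinorRep, hγ.exists_isSpinorDecomposition q,
    fun W₀ W₁ hdec => ?_⟩
  have hker : W₀ = harmonicTensor (2 * m + 1) q V ⊓ LinearMap.ker (dirac γ) := by
    rw [hdec.eq_monogenic hγ, (isCliffordMap_cliffordAction γ).monogenic_eq_inf_ker,
      dirac_eq_diracOp]
  refine ⟨fun f hf => ?_, fun f hf => ?_, hker,
    isQuotientOf_of_sup_eq hdec.disjoint hdec.sup_eq hker⟩
  · rw [dirac_eq_diracOp, hdec.dirac_eq_zero f hf, map_zero, neg_zero]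
  · rw [cliffordX_eq_vecOp, dirac_eq_diracOp]
    exact hdec.vec_dirac f hf
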